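/- **The logic.** $L^{\mu,\mathrm{ref}}$ is the following deductive system. Type variables $\alpha\in\Xi$ range over *program types*. Program types are generated from type variables by $\mathtt 1$, $\times$, $\to$, inductive types (the empty type, sums $+$, and least fixed points of functors that are strictly positive in the recursion variable, built from that variable and constant types by $\times$, $+$ and $A\to-$), $\forall\alpha$, $\exists\alpha$, a computational monad $\mathsf T$, general recursive types $\mu\alpha.A$ and reference types $\mathtt{ref}\,A$. *Logical types* contain the program types and a type $\mathtt{prop}$ of propositions, and are closed under $\times$, $\to$, inductive types and $\forall\alpha$ over program types. Besides the usual terms (products, functions, sums, constructors of inductive types and structural recursion into arbitrary logical types, type abstraction and application, pack and unpack) there are $\mathtt{ret}\,u:\mathsf T A$, $(x\leftarrow u;v):\mathsf T B$, $\mathtt{fold}\,u:\mu\alpha.A$ for $u:A[\mu\alpha.A/\alpha]$, $\mathtt{unfold}\,u:\mathsf T(A[\mu\alpha.A/\alpha])$ for $u:\mu\alpha.A$, $\mathtt{get}\,\ell:\mathsf T A$, $\mathtt{set}\,\ell\,v:\mathsf T\mathtt 1$ and $\mathtt{new}\,v:\mathsf T(\mathtt{ref}\,A)$ for $\ell:\mathtt{ref}\,A$,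 $v:A$, and $\mathtt{step}:\mathsf T\mathtt 1$. Propositions are built with $=_A,\top,\bot,\wedge,\vee,\Rightarrow,\forall x{:}A,\exists x{:}A$ ($A$ any logical type), $*,\mathbin{-\!\!*}$, the persistence modality $\square$, the later modality $\rhd$, $\ell\mapsto a$, and $\mathrm{wp}\,e\,\{x.\phi\}$ for $e:\mathsf T A$. Judgmental equality $\Xi\mid\Gamma\vdash u\equiv v:A$ and entailment $\Xi\mid\Gamma\mid\phi\vdash\psi$ are the least relations on well-typed terms closed under the following rules. * *Equality.* $\equiv$ is a congruence, stable under substitution of elements and of program types, containing the $\beta$- and $\eta$-laws of $\mathtt 1,\times,\to$, the empty type, $+$, $\forall\alpha$, $\exists\alpha$; the computation and uniqueness laws of structural recursion; the three monad laws; and (writing $u;v$ for $\_\leftarrow u;v$) $\mathtt{unfold}(\mathtt{fold}\,u)\equiv\mathtt{step};\mathtt{ret}\,u$; $\ (x\leftarrow\mathtt{unfold}\,u;\mathtt{ret}(\mathtt{fold}\,x))\equiv\mathtt{step};\mathtt{ret}\,u$; $\mathtt{set}\,u\,v;\mathtt{get}\,u\equiv\mathtt{step};\mathtt{set}\,u\,v;\mathtt{ret}\,v$;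 $\ (x\leftarrow\mathtt{new}\,u;\mathtt{set}\,x\,v;w)\equiv(x\leftarrow\mathtt{new}\,v;w)$; $\ \mathtt{set}\,u\,v;\mathtt{set}\,u\,w\equiv\mathtt{set}\,u\,w$; $\ (x\leftarrow\mathtt{get}\,u;y\leftarrow\mathtt{get}\,v;w)\equiv(y\leftarrow\mathtt{get}\,v;x\leftarrow\mathtt{get}\,u;w)$; $\ (x\leftarrow\mathtt{get}\,u;\mathtt{set}\,u\,x;w)\equiv(x\leftarrow\mathtt{get}\,u;w)$; and $\mathtt{step}$ commutes with $\mathtt{unfold},\mathtt{get},\mathtt{set},\mathtt{new}$. Moreover $u\equiv v$ whenever $\top\vdash u=_Av$. * *Higher-order logic.* Judgmentally equal propositions entail each other; cut; stability under substitution; the rules of intuitionistic first-order logic; the Lawvere rule ($\phi[x/y]\vdash\psi[x/y]$ in $\Gamma,x$ iff $\phi\wedge x=y\vdash\psi$ in $\Gamma,x,y$); propositional extensionality; induction over inductive types. * *Affine separation logic.* $*$ is monotone, associative and commutative with unit $\top$, $\phi*\psi\vdash\phi\wedge\psi$, and $\chi*\phi\vdash\psi$ iff $\chi\vdash\phi\mathbin{-\!\!*}\psi$.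 $\square$ is monotone, $\square\phi\vdash\phi*\square\phi$, $\square\phi\vdash\square\square\phi$, $\phi\wedge\square\psi\vdash\phi*\square\psi$, and propositions $\phi$ with $\phi\vdash\square\phi$ are closed under the first-order connectives. * *Later.* $\phi\vdash\rhd\phi$; $\rhd\phi\wedge\rhd\psi\vdash\rhd(\phi\wedge\psi)$; $\rhd\phi*\rhd\psi\vdash\rhd(\phi*\psi)$; $\phi\mathbin{-\!\!*}\psi\vdash\rhd\phi\mathbin{-\!\!*}\rhd\psi$; $\rhd\square\phi\dashv\vdash\square\rhd\phi$; $(\rhd\phi\Rightarrow\phi)\vdash\phi$; $\phi\vdash\rhd(u=v)$ iff $\phi\vdash\mathtt{fold}\,u=\mathtt{fold}\,v$; $\phi\vdash\rhd(u=_{\mathsf TA}v)$ iff $\phi\vdash(\mathtt{step};u)=(\mathtt{step};v)$. * *Weakest preconditions.* $(\forall x.\phi\mathbin{-\!\!*}\psi)*\mathrm{wp}\,e\{x.\phi\}\vdash\mathrm{wp}\,e\{x.\psi\}$; $\phi[e/x]\vdash\mathrm{wp}(\mathtt{ret}\,e)\{x.\phi\}$; $\mathrm{wp}\,e_1\{x.\mathrm{wp}\,e_2\{y.\phi\}\}\vdash\mathrm{wp}(x\leftarrow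 e_1;e_2)\{y.\phi\}$; $\exists x.\,\ell\mapsto x*\rhd(\ell\mapsto x\mathbin{-\!\!*}\phi)\vdash\mathrm{wp}(\mathtt{get}\,\ell)\{x.\phi\}$; $(\exists y.\ell\mapsto y)*(\ell\mapsto e\mathbin{-\!\!*}\phi)\vdash\mathrm{wp}(\mathtt{set}\,\ell\,e)\{\_.\phi\}$; $\forall x.(x\mapsto e\mathbin{-\!\!*}\phi)\vdash\mathrm{wp}(\mathtt{new}\,e)\{x.\phi\}$; $\rhd\phi\vdash\mathrm{wp}\,\mathtt{step}\,\{\_.\phi\}$. For program types $A,B$ and $e:\mathsf TB$ in a context with $f:A\to\mathsf TB$, $x:A$, let $S=\mu\sigma.\,\sigma\to A\to\mathsf TB$, let $\mathrm{unroll}(s)=\lambda x.\,(g\leftarrow\mathtt{unfold}\,s;\,g\,s\,x):A\to\mathsf TB$ for $s:S$, and define the recursive function $\mathtt{rec}\,f\,x.\,e:A\to\mathsf TB$ as $\mathrm{unroll}\bigl(\mathtt{fold}(\lambda s\,x.\,e[\mathrm{unroll}(s)/f])\bigr)$. **The programs.** For a type variable $\alpha$ let $\mathsf{List}\,\alpha$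 be the inductive type of functional lists, with $\mathsf{nil}$ and $\mathsf{cons}$, and let $\mathsf{LList}\,\alpha=\mu\rho.\,\mathtt 1+\mathtt{ref}(\alpha\times\rho)$ be the type of imperative linked lists. Define by structural recursion on functional lists $$l\approx\mathsf{nil}\;:=\;(l=\mathtt{fold}(\mathtt{inl}\,())),$$ $$l\approx\mathsf{cons}\,x\,xs\;:=\;\exists r{:}\mathtt{ref}(\alpha\times\mathsf{LList}\,\alpha).\,\exists l'{:}\mathsf{LList}\,\alpha.\;(l=\mathtt{fold}(\mathtt{inr}\,r))*r\mapsto(x,l')*(l'\approx xs),$$ $$\mathsf{nil}\oplus ys:=ys,\qquad \mathsf{cons}\,x\,xs\oplus ys:=\mathsf{cons}\,x\,(xs\oplus ys),$$ and define $\mathsf{append}:\mathsf{LList}\,\alpha\times\mathsf{LList}\,\alpha\to\mathsf T(\mathsf{LList}\,\alpha)$ by $$\mathsf{append}:=\mathtt{rec}\ f\,(l_1,l_2).\ z\leftarrow\mathtt{unfold}\,l_1;\ \mathtt{match}\ z\ \mathtt{with}\ \bigl[\ \mathtt{inl}\,\_\Rightarrow\mathtt{ret}\,l_2\ \big|\ \mathtt{inr}\,r\Rightarrow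 (a,l_1')\leftarrow\mathtt{get}\,r;\ l_3\leftarrow f(l_1',l_2);\ \mathtt{set}\,r\,(a,l_3);\ \mathtt{ret}(\mathtt{fold}(\mathtt{inr}\,r))\ \bigr].$$ **Theorem.** The following sequent is derivable in $L^{\mu,\mathrm{ref}}$: $$\alpha\mid\cdot\mid\top\;\vdash\;\forall u_1,u_2{:}\mathsf{List}\,\alpha.\ \forall l_1,l_2{:}\mathsf{LList}\,\alpha.\ \bigl(l_1\approx u_1 * l_2\approx u_2\bigr)\mathbin{-\!\!*}\mathrm{wp}\,\bigl(\mathsf{append}\,(l_1,l_2)\bigr)\,\{x.\ x\approx u_1\oplus u_2\}.$$ -/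

import Mathlib

namespace LMuRef

/-! ## Types

Raw types, with de Bruijn indices for type variables. The binders are `ind`, `all`, `ex` and `mu`.
Program types and logical types share one grammar, so that the inclusion of the former into the
latter is silent; the judgement `IsTp` tells them apart. -/

inductive Ty : Type
  | var (i : ℕ)
  | unit
  | prod (A B : Ty)
  | arr (A B : Ty)
  | empty
  | sum (A B : Ty)
  /-- `ind F` is the inductive type `F[X] → X`, where `X` is the variable `0` of `F` -/
  | ind (F : Ty)
  /-- the universal type `∀ α. A` -/
  | all (A : Ty)
  /-- the existential type `∃ α. A` -/
  | ex (A : Ty)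
  /-- the computational monad `T A` -/
  | mon (A : Ty)
  /-- the general recursive type `μ α. A` -/
  | mu (A : Ty)
  | ref (A : Ty)
  /-- the logical type of propositions -/
  | prop

/-- Extend a renaming under one binder. -/
def liftRen (ρ : ℕ → ℕ) : ℕ → ℕ
  | 0 => 0
  | i + 1 => ρ i + 1

namespace Ty

def rename : Ty → (ℕ → ℕ) → Ty
  | var i, ρ => var (ρ i)
  | unit, _ => unit
  | prod A B, ρ => prod (A.rename ρ) (B.rename ρ)
  | arr A B, ρ => arr (A.rename ρ) (B.rename ρ)
  | empty, _ => empty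
  | sum A B, ρ => sum (A.rename ρ) (B.rename ρ)
  | ind F, ρ => ind (F.rename (liftRen ρ))
  | all A, ρ => all (A.rename (liftRen ρ))
  | ex A, ρ => ex (A.rename (liftRen ρ))
  | mon A, ρ => mon (A.rename ρ)
  | mu A, ρ => mu (A.rename (liftRen ρ))
  | ref A, ρ => ref (A.rename ρ)
  | prop, _ => prop

/-- Weakening by one type variable. -/
def shift (A : Ty) : Ty := A.rename Nat.succ

/-- Extend a substitution under one binder. -/
def up (τ : ℕ → Ty) : ℕ → Ty
  | 0 => var 0
  | i + 1 => (τ i).shift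

/-- Capture-avoiding simultaneous substitution. -/
def subst : Ty → (ℕ → Ty) → Ty
  | var i, τ => τ i
  | unit, _ => unit
  | prod A B, τ => prod (A.subst τ) (B.subst τ)
  | arr A B, τ => arr (A.subst τ) (B.subst τ)
  | empty, _ => empty
  | sum A B, τ => sum (A.subst τ) (B.subst τ)
  | ind F, τ => ind (F.subst (up τ))
  | all A, τ => all (A.subst (up τ))
  | ex A, τ => ex (A.subst (up τ))
  | mon A, τ => mon (A.subst τ)
  | mu A, τ => mu (A.subst (up τ))
  | ref A, τ => ref (A.subst τ)
  | prop, _ => prop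

/-- The substitution that replaces variable `0` by `B` and lowers the others. -/
def single (B : Ty) : ℕ → Ty
  | 0 => B
  | i + 1 => var i

/-- `A.inst B` is `A[B/α]`, where `α` is variable `0`. -/
def inst (A B : Ty) : Ty := A.subst (single B)

end Ty

/-- The flag that separates program types `P` from logical types `L`. -/
inductive Flag : Type
  | P
  | L

/-- `SPos F`: the variable `0` occurs only strictly positively in `F`, that is, `F` is a
polynomial functor of this variable. -/
inductive SPos : Ty → Prop
  | self : SPos (.var 0)
  | const (A : Ty) : SPos A.shift
  | prod {F G : Ty} : SPos F → SPos G → SPos (.prod F G)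
  | sum {F G : Ty} : SPos F → SPos G → SPos (.sum F G)
  | arr (A : Ty) {F : Ty} : SPos F → SPos (.arr A.shift F)

/-- `IsTp ι Ξ A`: in the context of the type variables `0, …, Ξ - 1`, which range over program
types, `A` is a program type (`ι = P`) or a logical type (`ι = L`). -/
inductive IsTp : Flag → ℕ → Ty → Prop
  | var {ι : Flag} {Ξ i : ℕ} : i < Ξ → IsTp ι Ξ (.var i)
  | unit {ι : Flag} {Ξ : ℕ} : IsTp ι Ξ .unit
  | prod {ι : Flag} {Ξ : ℕ} {A B : Ty} : IsTp ι Ξ A → IsTp ι Ξ B → IsTp ι Ξ (.prod A B)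
  | arr {ι : Flag} {Ξ : ℕ} {A B : Ty} : IsTp ι Ξ A → IsTp ι Ξ B → IsTp ι Ξ (.arr A B)
  | empty {ι : Flag} {Ξ : ℕ} : IsTp ι Ξ .empty
  | sum {ι : Flag} {Ξ : ℕ} {A B : Ty} : IsTp ι Ξ A → IsTp ι Ξ B → IsTp ι Ξ (.sum A B)
  | ind {ι : Flag} {Ξ : ℕ} {F : Ty} : SPos F → IsTp ι (Ξ + 1) F → IsTp ι Ξ (.ind F)
  | all {ι : Flag} {Ξ : ℕ} {A : Ty} : IsTp ι (Ξ + 1) A → IsTp ι Ξ (.all A)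
  | ex {Ξ : ℕ} {A : Ty} : IsTp .P (Ξ + 1) A → IsTp .P Ξ (.ex A)
  | mon {Ξ : ℕ} {A : Ty} : IsTp .P Ξ A → IsTp .P Ξ (.mon A)
  | mu {Ξ : ℕ} {A : Ty} : IsTp .P (Ξ + 1) A → IsTp .P Ξ (.mu A)
  | ref {Ξ : ℕ} {A : Ty} : IsTp .P Ξ A → IsTp .P Ξ (.ref A)
  | prop {Ξ : ℕ} : IsTp .L Ξ .prop
  | incl {Ξ : ℕ} {A : Ty} : IsTp .P Ξ A → IsTp .L Ξ A

/-- Element contexts; the most recent variable comes first. -/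
abbrev Ctx : Type := List Ty

def IsCtx (Ξ : ℕ) (Γ : Ctx) : Prop := ∀ A ∈ Γ, IsTp .L Ξ A

/-! ## Elements and propositions

Raw elements, with de Bruijn indices for element variables. Propositions are the elements of the
type `prop`. -/

inductive Tm : Type
  | var (i : ℕ)
  | tt
  | pair (u v : Tm)
  | fst (u : Tm)
  | snd (u : Tm)
  /-- `λ x : A. u`, binding one variable in `u` -/
  | lam (A : Ty) (u : Tm)
  | app (u v : Tm)
  /-- elimination of the empty type into `C` -/
  | absurd (C : Ty) (u : Tm)
  /-- left injection; `B` is the other summand -/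
  | inl (B : Ty) (u : Tm)
  /-- right injection; `A` is the other summand -/
  | inr (A : Ty) (u : Tm)
  /-- `match u with inl x ⇒ v | inr y ⇒ w`, binding one variable in `v` and one in `w` -/
  | case (u v w : Tm)
  /-- the constructor `F[ind F] → ind F` of an inductive type -/
  | con (F : Ty) (u : Tm)
  /-- structural recursion on `u : ind F` with the step function `e : F[C] → C` -/
  | iter (F C : Ty) (e u : Tm)
  /-- `Λ α. u`, binding one type variable in `u` -/
  | tlam (u : Tm)
  | tapp (u : Tm) (B : Ty)
  /-- `pack (B, u)` as an element of `∃ α. A` -/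
  | pack (A B : Ty) (u : Tm)
  /-- `let pack (α, x) = u in v`, binding one type variable and one element variable in `v` -/
  | unpack (u v : Tm)
  | ret (u : Tm)
  /-- `x ← u; v`, binding one variable in `v` -/
  | bind (u v : Tm)
  /-- `fold u` as an element of `μ α. A` -/
  | fold (A : Ty) (u : Tm)
  | unfold (u : Tm)
  | get (u : Tm)
  | set (u v : Tm)
  | new (u : Tm)
  | step
  /-- the proposition that `u` and `v` are equal elements of `A` -/
  | eq (A : Ty) (u v : Tm)
  | top
  | bot
  | and (φ ψ : Tm)
  | or (φ ψ : Tm)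
  | imp (φ ψ : Tm)
  /-- `∀ x : A. φ`, binding one variable in `φ` -/
  | all (A : Ty) (φ : Tm)
  /-- `∃ x : A. φ`, binding one variable in `φ` -/
  | ex (A : Ty) (φ : Tm)
  /-- separating conjunction -/
  | sep (φ ψ : Tm)
  /-- separating implication -/
  | wand (φ ψ : Tm)
  /-- the persistence modality -/
  | box (φ : Tm)
  /-- the later modality -/
  | later (φ : Tm)
  /-- `ℓ ↦ u` -/
  | pts (l u : Tm)
  /-- the weakest precondition `wp e {x. φ}`, binding one variable in `φ` -/
  | wp (e φ : Tm)

namespace Tm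

/-- Renaming of element variables. -/
def rename : Tm → (ℕ → ℕ) → Tm
  | var i, ρ => var (ρ i)
  | tt, _ => tt
  | pair u v, ρ => pair (u.rename ρ) (v.rename ρ)
  | fst u, ρ => fst (u.rename ρ)
  | snd u, ρ => snd (u.rename ρ)
  | lam A u, ρ => lam A (u.rename (liftRen ρ))
  | app u v, ρ => app (u.rename ρ) (v.rename ρ)
  | absurd C u, ρ => absurd C (u.rename ρ)
  | inl B u, ρ => inl B (u.rename ρ)
  | inr A u, ρ => inr A (u.rename ρ)
  | case u v w, ρ => case (u.rename ρ) (v.rename (liftRen ρ)) (w.rename (liftRen ρ))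
  | con F u, ρ => con F (u.rename ρ)
  | iter F C e u, ρ => iter F C (e.rename ρ) (u.rename ρ)
  | tlam u, ρ => tlam (u.rename ρ)
  | tapp u B, ρ => tapp (u.rename ρ) B
  | pack A B u, ρ => pack A B (u.rename ρ)
  | unpack u v, ρ => unpack (u.rename ρ) (v.rename (liftRen ρ))
  | ret u, ρ => ret (u.rename ρ)
  | bind u v, ρ => bind (u.rename ρ) (v.rename (liftRen ρ))
  | fold A u, ρ => fold A (u.rename ρ)
  | unfold u, ρ => unfold (u.rename ρ)
  | get u, ρ => get (u.rename ρ)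
  | set u v, ρ => set (u.rename ρ) (v.rename ρ)
  | new u, ρ => new (u.rename ρ)
  | step, _ => step
  | eq A u v, ρ => eq A (u.rename ρ) (v.rename ρ)
  | top, _ => top
  | bot, _ => bot
  | and φ ψ, ρ => and (φ.rename ρ) (ψ.rename ρ)
  | or φ ψ, ρ => or (φ.rename ρ) (ψ.rename ρ)
  | imp φ ψ, ρ => imp (φ.rename ρ) (ψ.rename ρ)
  | all A φ, ρ => all A (φ.rename (liftRen ρ))
  | ex A φ, ρ => ex A (φ.rename (liftRen ρ))
  | sep φ ψ, ρ => sep (φ.rename ρ) (ψ.rename ρ)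
  | wand φ ψ, ρ => wand (φ.rename ρ) (ψ.rename ρ)
  | box φ, ρ => box (φ.rename ρ)
  | later φ, ρ => later (φ.rename ρ)
  | pts l u, ρ => pts (l.rename ρ) (u.rename ρ)
  | wp e φ, ρ => wp (e.rename ρ) (φ.rename (liftRen ρ))

/-- Weakening by one element variable. -/
def shift (u : Tm) : Tm := u.rename Nat.succ

/-- Weakening by one element variable below the most recent one. -/
def shift₁ (u : Tm) : Tm := u.rename (liftRen Nat.succ)

/-- Substitution of types for the type variables. -/
def tsubst : Tm → (ℕ → Ty) → Tm
  | var i, _ => var i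
  | tt, _ => tt
  | pair u v, τ => pair (u.tsubst τ) (v.tsubst τ)
  | fst u, τ => fst (u.tsubst τ)
  | snd u, τ => snd (u.tsubst τ)
  | lam A u, τ => lam (A.subst τ) (u.tsubst τ)
  | app u v, τ => app (u.tsubst τ) (v.tsubst τ)
  | absurd C u, τ => absurd (C.subst τ) (u.tsubst τ)
  | inl B u, τ => inl (B.subst τ) (u.tsubst τ)
  | inr A u, τ => inr (A.subst τ) (u.tsubst τ)
  | case u v w, τ => case (u.tsubst τ) (v.tsubst τ) (w.tsubst τ)
  | con F u, τ => con (F.subst (Ty.up τ)) (u.tsubst τ)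
  | iter F C e u, τ => iter (F.subst (Ty.up τ)) (C.subst τ) (e.tsubst τ) (u.tsubst τ)
  | tlam u, τ => tlam (u.tsubst (Ty.up τ))
  | tapp u B, τ => tapp (u.tsubst τ) (B.subst τ)
  | pack A B u, τ => pack (A.subst (Ty.up τ)) (B.subst τ) (u.tsubst τ)
  | unpack u v, τ => unpack (u.tsubst τ) (v.tsubst (Ty.up τ))
  | ret u, τ => ret (u.tsubst τ)
  | bind u v, τ => bind (u.tsubst τ) (v.tsubst τ)
  | fold A u, τ => fold (A.subst (Ty.up τ)) (u.tsubst τ)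
  | unfold u, τ => unfold (u.tsubst τ)
  | get u, τ => get (u.tsubst τ)
  | set u v, τ => set (u.tsubst τ) (v.tsubst τ)
  | new u, τ => new (u.tsubst τ)
  | step, _ => step
  | eq A u v, τ => eq (A.subst τ) (u.tsubst τ) (v.tsubst τ)
  | top, _ => top
  | bot, _ => bot
  | and φ ψ, τ => and (φ.tsubst τ) (ψ.tsubst τ)
  | or φ ψ, τ => or (φ.tsubst τ) (ψ.tsubst τ)
  | imp φ ψ, τ => imp (φ.tsubst τ) (ψ.tsubst τ)
  | all A φ, τ => all (A.subst τ) (φ.tsubst τ)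
  | ex A φ, τ => ex (A.subst τ) (φ.tsubst τ)
  | sep φ ψ, τ => sep (φ.tsubst τ) (ψ.tsubst τ)
  | wand φ ψ, τ => wand (φ.tsubst τ) (ψ.tsubst τ)
  | box φ, τ => box (φ.tsubst τ)
  | later φ, τ => later (φ.tsubst τ)
  | pts l u, τ => pts (l.tsubst τ) (u.tsubst τ)
  | wp e φ, τ => wp (e.tsubst τ) (φ.tsubst τ)

/-- Weakening by one type variable. -/
def tshift (u : Tm) : Tm := u.tsubst fun i => .var (i + 1)

/-- `u.tinst B` is `u[B/α]`, where `α` is the type variable `0`. -/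
def tinst (u : Tm) (B : Ty) : Tm := u.tsubst (Ty.single B)

/-- Extend a substitution under one binder of an element variable. -/
def up (σ : ℕ → Tm) : ℕ → Tm
  | 0 => var 0
  | i + 1 => (σ i).shift

/-- Capture-avoiding simultaneous substitution for the element variables. -/
def subst : Tm → (ℕ → Tm) → Tm
  | var i, σ => σ i
  | tt, _ => tt
  | pair u v, σ => pair (u.subst σ) (v.subst σ)
  | fst u, σ => fst (u.subst σ)
  | snd u, σ => snd (u.subst σ)
  | lam A u, σ => lam A (u.subst (up σ))
  | app u v, σ => app (u.subst σ) (v.subst σ)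
  | absurd C u, σ => absurd C (u.subst σ)
  | inl B u, σ => inl B (u.subst σ)
  | inr A u, σ => inr A (u.subst σ)
  | case u v w, σ => case (u.subst σ) (v.subst (up σ)) (w.subst (up σ))
  | con F u, σ => con F (u.subst σ)
  | iter F C e u, σ => iter F C (e.subst σ) (u.subst σ)
  | tlam u, σ => tlam (u.subst fun i => (σ i).tshift)
  | tapp u B, σ => tapp (u.subst σ) B
  | pack A B u, σ => pack A B (u.subst σ)
  | unpack u v, σ => unpack (u.subst σ) (v.subst (up fun i => (σ i).tshift))
  | ret u, σ => ret (u.subst σ)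
  | bind u v, σ => bind (u.subst σ) (v.subst (up σ))
  | fold A u, σ => fold A (u.subst σ)
  | unfold u, σ => unfold (u.subst σ)
  | get u, σ => get (u.subst σ)
  | set u v, σ => set (u.subst σ) (v.subst σ)
  | new u, σ => new (u.subst σ)
  | step, _ => step
  | eq A u v, σ => eq A (u.subst σ) (v.subst σ)
  | top, _ => top
  | bot, _ => bot
  | and φ ψ, σ => and (φ.subst σ) (ψ.subst σ)
  | or φ ψ, σ => or (φ.subst σ) (ψ.subst σ)
  | imp φ ψ, σ => imp (φ.subst σ) (ψ.subst σ)
  | all A φ, σ => all A (φ.subst (up σ))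
  | ex A φ, σ => ex A (φ.subst (up σ))
  | sep φ ψ, σ => sep (φ.subst σ) (ψ.subst σ)
  | wand φ ψ, σ => wand (φ.subst σ) (ψ.subst σ)
  | box φ, σ => box (φ.subst σ)
  | later φ, σ => later (φ.subst σ)
  | pts l u, σ => pts (l.subst σ) (u.subst σ)
  | wp e φ, σ => wp (e.subst σ) (φ.subst (up σ))

/-- The substitution that replaces variable `0` by `v` and lowers the others. -/
def single (v : Tm) : ℕ → Tm
  | 0 => v
  | i + 1 => var i

/-- `u.inst v` is `u[v/x]`, where `x` is variable `0`. -/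
def inst (u v : Tm) : Tm := u.subst (single v)

/-- `u; v`, that is, `_ ← u; v`. -/
def seq (u v : Tm) : Tm := bind u v.shift

/-- The functorial action of a strictly positive `F` at `f : D → C`, applied to `t : F[D]`. -/
def map (C : Ty) : Ty → Tm → Tm → Tm
  | .var 0, f, t => app f t
  | .prod F G, f, t => pair (map C F f (fst t)) (map C G f (snd t))
  | .sum F G, f, t =>
      case t (inl (G.inst C) (map C F f.shift (var 0))) (inr (F.inst C) (map C G f.shift (var 0)))
  | .arr A F, f, t => lam (A.inst C) (map C F f.shift (app t.shift (var 0)))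
  | _, _, t => t

/-- The lifting of a predicate `P : D → prop` along a strictly positive `F`, at `t : F[D]`: the
predicate `P` holds at all positions of `t`. -/
def lift (D : Ty) : Ty → Tm → Tm → Tm
  | .var 0, P, t => app P t
  | .prod F G, P, t => and (lift D F P (fst t)) (lift D G P (snd t))
  | .sum F G, P, t => case t (lift D F P.shift (var 0)) (lift D G P.shift (var 0))
  | .arr A F, P, t => all (A.inst D) (lift D F P.shift (app t.shift (var 0)))
  | _, _, _ => top

end Tm

/-! ## Typing -/

open Tm in
/-- `HasType Ξ Γ u A` is the judgement `Ξ ∣ Γ ⊢ u : A`; for `A = prop` it says that `u` is a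
proposition in context. -/
inductive HasType : ℕ → Ctx → Tm → Ty → Prop
  | var {Ξ : ℕ} {Γ : Ctx} {i : ℕ} {A : Ty} : Γ[i]? = some A → HasType Ξ Γ (var i) A
  | tt {Ξ : ℕ} {Γ : Ctx} : HasType Ξ Γ tt .unit
  | pair {Ξ : ℕ} {Γ : Ctx} {u v : Tm} {A B : Ty} :
      HasType Ξ Γ u A → HasType Ξ Γ v B → HasType Ξ Γ (pair u v) (.prod A B)
  | fst {Ξ : ℕ} {Γ : Ctx} {u : Tm} {A B : Ty} :
      HasType Ξ Γ u (.prod A B) → HasType Ξ Γ (fst u) A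
  | snd {Ξ : ℕ} {Γ : Ctx} {u : Tm} {A B : Ty} :
      HasType Ξ Γ u (.prod A B) → HasType Ξ Γ (snd u) B
  | lam {Ξ : ℕ} {Γ : Ctx} {u : Tm} {A B : Ty} :
      IsTp .L Ξ A → HasType Ξ (A :: Γ) u B → HasType Ξ Γ (lam A u) (.arr A B)
  | app {Ξ : ℕ} {Γ : Ctx} {u v : Tm} {A B : Ty} :
      HasType Ξ Γ u (.arr A B) → HasType Ξ Γ v A → HasType Ξ Γ (app u v) B
  | absurd {Ξ : ℕ} {Γ : Ctx} {u : Tm} {C : Ty} :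
      IsTp .L Ξ C → HasType Ξ Γ u .empty → HasType Ξ Γ (absurd C u) C
  | inl {Ξ : ℕ} {Γ : Ctx} {u : Tm} {A B : Ty} :
      IsTp .L Ξ B → HasType Ξ Γ u A → HasType Ξ Γ (inl B u) (.sum A B)
  | inr {Ξ : ℕ} {Γ : Ctx} {u : Tm} {A B : Ty} :
      IsTp .L Ξ A → HasType Ξ Γ u B → HasType Ξ Γ (inr A u) (.sum A B)
  | case {Ξ : ℕ} {Γ : Ctx} {u v w : Tm} {A B C : Ty} :
      HasType Ξ Γ u (.sum A B) → HasType Ξ (A :: Γ) v C → HasType Ξ (B :: Γ) w C →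
      HasType Ξ Γ (case u v w) C
  | con {Ξ : ℕ} {Γ : Ctx} {u : Tm} {F : Ty} :
      IsTp .L Ξ (.ind F) → HasType Ξ Γ u (F.inst (.ind F)) → HasType Ξ Γ (con F u) (.ind F)
  | iter {Ξ : ℕ} {Γ : Ctx} {e u : Tm} {F C : Ty} :
      IsTp .L Ξ (.ind F) → IsTp .L Ξ C → HasType Ξ Γ e (.arr (F.inst C) C) →
      HasType Ξ Γ u (.ind F) → HasType Ξ Γ (iter F C e u) C
  | tlam {Ξ : ℕ} {Γ : Ctx} {u : Tm} {A : Ty} :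
      HasType (Ξ + 1) (Γ.map Ty.shift) u A → HasType Ξ Γ (tlam u) (.all A)
  | tapp {Ξ : ℕ} {Γ : Ctx} {u : Tm} {A B : Ty} :
      HasType Ξ Γ u (.all A) → IsTp .P Ξ B → HasType Ξ Γ (tapp u B) (A.inst B)
  | pack {Ξ : ℕ} {Γ : Ctx} {u : Tm} {A B : Ty} :
      IsTp .P (Ξ + 1) A → IsTp .P Ξ B → HasType Ξ Γ u (A.inst B) →
      HasType Ξ Γ (pack A B u) (.ex A)
  | unpack {Ξ : ℕ} {Γ : Ctx} {u v : Tm} {A C : Ty} :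
      IsTp .P Ξ C → HasType Ξ Γ u (.ex A) →
      HasType (Ξ + 1) (A :: Γ.map Ty.shift) v C.shift → HasType Ξ Γ (unpack u v) C
  | ret {Ξ : ℕ} {Γ : Ctx} {u : Tm} {A : Ty} :
      IsTp .P Ξ A → HasType Ξ Γ u A → HasType Ξ Γ (ret u) (.mon A)
  | bind {Ξ : ℕ} {Γ : Ctx} {u v : Tm} {A B : Ty} :
      HasType Ξ Γ u (.mon A) → HasType Ξ (A :: Γ) v (.mon B) → HasType Ξ Γ (bind u v) (.mon B)
  | fold {Ξ : ℕ} {Γ : Ctx} {u : Tm} {A : Ty} :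
      IsTp .P (Ξ + 1) A → HasType Ξ Γ u (A.inst (.mu A)) → HasType Ξ Γ (fold A u) (.mu A)
  | unfold {Ξ : ℕ} {Γ : Ctx} {u : Tm} {A : Ty} :
      HasType Ξ Γ u (.mu A) → HasType Ξ Γ (unfold u) (.mon (A.inst (.mu A)))
  | get {Ξ : ℕ} {Γ : Ctx} {u : Tm} {A : Ty} :
      HasType Ξ Γ u (.ref A) → HasType Ξ Γ (get u) (.mon A)
  | set {Ξ : ℕ} {Γ : Ctx} {u v : Tm} {A : Ty} :
      HasType Ξ Γ u (.ref A) → HasType Ξ Γ v A → HasType Ξ Γ (set u v) (.mon .unit)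
  | new {Ξ : ℕ} {Γ : Ctx} {u : Tm} {A : Ty} :
      IsTp .P Ξ A → HasType Ξ Γ u A → HasType Ξ Γ (new u) (.mon (.ref A))
  | step {Ξ : ℕ} {Γ : Ctx} : HasType Ξ Γ step (.mon .unit)
  | eq {Ξ : ℕ} {Γ : Ctx} {u v : Tm} {A : Ty} :
      IsTp .L Ξ A → HasType Ξ Γ u A → HasType Ξ Γ v A → HasType Ξ Γ (eq A u v) .prop
  | top {Ξ : ℕ} {Γ : Ctx} : HasType Ξ Γ top .prop
  | bot {Ξ : ℕ} {Γ : Ctx} : HasType Ξ Γ bot .prop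
  | and {Ξ : ℕ} {Γ : Ctx} {φ ψ : Tm} :
      HasType Ξ Γ φ .prop → HasType Ξ Γ ψ .prop → HasType Ξ Γ (and φ ψ) .prop
  | or {Ξ : ℕ} {Γ : Ctx} {φ ψ : Tm} :
      HasType Ξ Γ φ .prop → HasType Ξ Γ ψ .prop → HasType Ξ Γ (or φ ψ) .prop
  | imp {Ξ : ℕ} {Γ : Ctx} {φ ψ : Tm} :
      HasType Ξ Γ φ .prop → HasType Ξ Γ ψ .prop → HasType Ξ Γ (imp φ ψ) .prop
  | all {Ξ : ℕ} {Γ : Ctx} {φ : Tm} {A : Ty} :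
      IsTp .L Ξ A → HasType Ξ (A :: Γ) φ .prop → HasType Ξ Γ (all A φ) .prop
  | ex {Ξ : ℕ} {Γ : Ctx} {φ : Tm} {A : Ty} :
      IsTp .L Ξ A → HasType Ξ (A :: Γ) φ .prop → HasType Ξ Γ (ex A φ) .prop
  | sep {Ξ : ℕ} {Γ : Ctx} {φ ψ : Tm} :
      HasType Ξ Γ φ .prop → HasType Ξ Γ ψ .prop → HasType Ξ Γ (sep φ ψ) .prop
  | wand {Ξ : ℕ} {Γ : Ctx} {φ ψ : Tm} :
      HasType Ξ Γ φ .prop → HasType Ξ Γ ψ .prop → HasType Ξ Γ (wand φ ψ) .prop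
  | box {Ξ : ℕ} {Γ : Ctx} {φ : Tm} : HasType Ξ Γ φ .prop → HasType Ξ Γ (box φ) .prop
  | later {Ξ : ℕ} {Γ : Ctx} {φ : Tm} : HasType Ξ Γ φ .prop → HasType Ξ Γ (later φ) .prop
  | pts {Ξ : ℕ} {Γ : Ctx} {l u : Tm} {A : Ty} :
      HasType Ξ Γ l (.ref A) → HasType Ξ Γ u A → HasType Ξ Γ (pts l u) .prop
  | wp {Ξ : ℕ} {Γ : Ctx} {e φ : Tm} {A : Ty} :
      HasType Ξ Γ e (.mon A) → HasType Ξ (A :: Γ) φ .prop → HasType Ξ Γ (wp e φ) .prop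

/-- `IsSubst Ξ Γ σ Δ`: over the type context `Ξ`, the substitution `σ` sends the variables of `Δ`
to elements in context `Γ`. -/
def IsSubst (Ξ : ℕ) (Γ : Ctx) (σ : ℕ → Tm) (Δ : Ctx) : Prop :=
  ∀ (i : ℕ) (A : Ty), Δ[i]? = some A → HasType Ξ Γ (σ i) A

/-- `IsTySubst Ξ τ Θ`: `τ` sends the type variables of `Θ` to program types over `Ξ`. -/
def IsTySubst (Ξ : ℕ) (τ : ℕ → Ty) (Θ : ℕ) : Prop := ∀ i < Θ, IsTp .P Ξ (τ i)

/-! ## Judgmental equality and entailment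

The two judgements depend on each other: judgmentally equal propositions entail each other, and
the equality reflection rule turns an entailed equation into a judgmental one. The premises make
sure that both judgements only relate well-typed elements. -/

open Tm in
mutual

/-- `EqTm Ξ Γ u v A` is the judgement `Ξ ∣ Γ ⊢ u ≡ v : A`. -/
inductive EqTm : ℕ → Ctx → Tm → Tm → Ty → Prop
  -- equivalence relation, stable under substitution
  | refl {Ξ : ℕ} {Γ : Ctx} {u : Tm} {A : Ty} : HasType Ξ Γ u A → EqTm Ξ Γ u u A
  | symm {Ξ : ℕ} {Γ : Ctx} {u v : Tm} {A : Ty} : EqTm Ξ Γ u v A → EqTm Ξ Γ v u A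
  | trans {Ξ : ℕ} {Γ : Ctx} {u v w : Tm} {A : Ty} :
      EqTm Ξ Γ u v A → EqTm Ξ Γ v w A → EqTm Ξ Γ u w A
  | subst {Ξ : ℕ} {Γ Δ : Ctx} {σ : ℕ → Tm} {u v : Tm} {A : Ty} :
      IsCtx Ξ Γ → IsCtx Ξ Δ → IsSubst Ξ Γ σ Δ → EqTm Ξ Δ u v A →
      EqTm Ξ Γ (u.subst σ) (v.subst σ) A
  | tsubst {Ξ Θ : ℕ} {Γ : Ctx} {τ : ℕ → Ty} {u v : Tm} {A : Ty} :
      IsCtx Θ Γ → IsTySubst Ξ τ Θ → EqTm Θ Γ u v A →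
      EqTm Ξ (Γ.map fun B => B.subst τ) (u.tsubst τ) (v.tsubst τ) (A.subst τ)
  -- congruence
  | pair_congr {Ξ : ℕ} {Γ : Ctx} {u u' v v' : Tm} {A B : Ty} :
      EqTm Ξ Γ u u' A → EqTm Ξ Γ v v' B → EqTm Ξ Γ (pair u v) (pair u' v') (.prod A B)
  | fst_congr {Ξ : ℕ} {Γ : Ctx} {u u' : Tm} {A B : Ty} :
      EqTm Ξ Γ u u' (.prod A B) → EqTm Ξ Γ (fst u) (fst u') A
  | snd_congr {Ξ : ℕ} {Γ : Ctx} {u u' : Tm} {A B : Ty} :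
      EqTm Ξ Γ u u' (.prod A B) → EqTm Ξ Γ (snd u) (snd u') B
  | lam_congr {Ξ : ℕ} {Γ : Ctx} {u u' : Tm} {A B : Ty} :
      IsTp .L Ξ A → EqTm Ξ (A :: Γ) u u' B → EqTm Ξ Γ (lam A u) (lam A u') (.arr A B)
  | app_congr {Ξ : ℕ} {Γ : Ctx} {u u' v v' : Tm} {A B : Ty} :
      EqTm Ξ Γ u u' (.arr A B) → EqTm Ξ Γ v v' A → EqTm Ξ Γ (app u v) (app u' v') B
  | absurd_congr {Ξ : ℕ} {Γ : Ctx} {u u' : Tm} {C : Ty} :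
      IsTp .L Ξ C → EqTm Ξ Γ u u' .empty → EqTm Ξ Γ (absurd C u) (absurd C u') C
  | inl_congr {Ξ : ℕ} {Γ : Ctx} {u u' : Tm} {A B : Ty} :
      IsTp .L Ξ B → EqTm Ξ Γ u u' A → EqTm Ξ Γ (inl B u) (inl B u') (.sum A B)
  | inr_congr {Ξ : ℕ} {Γ : Ctx} {u u' : Tm} {A B : Ty} :
      IsTp .L Ξ A → EqTm Ξ Γ u u' B → EqTm Ξ Γ (inr A u) (inr A u') (.sum A B)
  | case_congr {Ξ : ℕ} {Γ : Ctx} {u u' v v' w w' : Tm} {A B C : Ty} :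
      EqTm Ξ Γ u u' (.sum A B) → EqTm Ξ (A :: Γ) v v' C → EqTm Ξ (B :: Γ) w w' C →
      EqTm Ξ Γ (case u v w) (case u' v' w') C
  | con_congr {Ξ : ℕ} {Γ : Ctx} {u u' : Tm} {F : Ty} :
      IsTp .L Ξ (.ind F) → EqTm Ξ Γ u u' (F.inst (.ind F)) →
      EqTm Ξ Γ (con F u) (con F u') (.ind F)
  | iter_congr {Ξ : ℕ} {Γ : Ctx} {e e' u u' : Tm} {F C : Ty} :
      IsTp .L Ξ (.ind F) → IsTp .L Ξ C → EqTm Ξ Γ e e' (.arr (F.inst C) C) →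
      EqTm Ξ Γ u u' (.ind F) → EqTm Ξ Γ (iter F C e u) (iter F C e' u') C
  | tlam_congr {Ξ : ℕ} {Γ : Ctx} {u u' : Tm} {A : Ty} :
      EqTm (Ξ + 1) (Γ.map Ty.shift) u u' A → EqTm Ξ Γ (tlam u) (tlam u') (.all A)
  | tapp_congr {Ξ : ℕ} {Γ : Ctx} {u u' : Tm} {A B : Ty} :
      EqTm Ξ Γ u u' (.all A) → IsTp .P Ξ B → EqTm Ξ Γ (tapp u B) (tapp u' B) (A.inst B)
  | pack_congr {Ξ : ℕ} {Γ : Ctx} {u u' : Tm} {A B : Ty} :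
      IsTp .P (Ξ + 1) A → IsTp .P Ξ B → EqTm Ξ Γ u u' (A.inst B) →
      EqTm Ξ Γ (pack A B u) (pack A B u') (.ex A)
  | unpack_congr {Ξ : ℕ} {Γ : Ctx} {u u' v v' : Tm} {A C : Ty} :
      IsTp .P Ξ C → EqTm Ξ Γ u u' (.ex A) →
      EqTm (Ξ + 1) (A :: Γ.map Ty.shift) v v' C.shift →
      EqTm Ξ Γ (unpack u v) (unpack u' v') C
  | ret_congr {Ξ : ℕ} {Γ : Ctx} {u u' : Tm} {A : Ty} :
      IsTp .P Ξ A → EqTm Ξ Γ u u' A → EqTm Ξ Γ (ret u) (ret u') (.mon A)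
  | bind_congr {Ξ : ℕ} {Γ : Ctx} {u u' v v' : Tm} {A B : Ty} :
      EqTm Ξ Γ u u' (.mon A) → EqTm Ξ (A :: Γ) v v' (.mon B) →
      EqTm Ξ Γ (bind u v) (bind u' v') (.mon B)
  | fold_congr {Ξ : ℕ} {Γ : Ctx} {u u' : Tm} {A : Ty} :
      IsTp .P (Ξ + 1) A → EqTm Ξ Γ u u' (A.inst (.mu A)) →
      EqTm Ξ Γ (fold A u) (fold A u') (.mu A)
  | unfold_congr {Ξ : ℕ} {Γ : Ctx} {u u' : Tm} {A : Ty} :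
      EqTm Ξ Γ u u' (.mu A) → EqTm Ξ Γ (unfold u) (unfold u') (.mon (A.inst (.mu A)))
  | get_congr {Ξ : ℕ} {Γ : Ctx} {u u' : Tm} {A : Ty} :
      EqTm Ξ Γ u u' (.ref A) → EqTm Ξ Γ (get u) (get u') (.mon A)
  | set_congr {Ξ : ℕ} {Γ : Ctx} {u u' v v' : Tm} {A : Ty} :
      EqTm Ξ Γ u u' (.ref A) → EqTm Ξ Γ v v' A → EqTm Ξ Γ (set u v) (set u' v') (.mon .unit)
  | new_congr {Ξ : ℕ} {Γ : Ctx} {u u' : Tm} {A : Ty} :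
      IsTp .P Ξ A → EqTm Ξ Γ u u' A → EqTm Ξ Γ (new u) (new u') (.mon (.ref A))
  | eq_congr {Ξ : ℕ} {Γ : Ctx} {u u' v v' : Tm} {A : Ty} :
      IsTp .L Ξ A → EqTm Ξ Γ u u' A → EqTm Ξ Γ v v' A →
      EqTm Ξ Γ (eq A u v) (eq A u' v') .prop
  | and_congr {Ξ : ℕ} {Γ : Ctx} {φ φ' ψ ψ' : Tm} :
      EqTm Ξ Γ φ φ' .prop → EqTm Ξ Γ ψ ψ' .prop → EqTm Ξ Γ (and φ ψ) (and φ' ψ') .prop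
  | or_congr {Ξ : ℕ} {Γ : Ctx} {φ φ' ψ ψ' : Tm} :
      EqTm Ξ Γ φ φ' .prop → EqTm Ξ Γ ψ ψ' .prop → EqTm Ξ Γ (or φ ψ) (or φ' ψ') .prop
  | imp_congr {Ξ : ℕ} {Γ : Ctx} {φ φ' ψ ψ' : Tm} :
      EqTm Ξ Γ φ φ' .prop → EqTm Ξ Γ ψ ψ' .prop → EqTm Ξ Γ (imp φ ψ) (imp φ' ψ') .prop
  | all_congr {Ξ : ℕ} {Γ : Ctx} {φ φ' : Tm} {A : Ty} :
      IsTp .L Ξ A → EqTm Ξ (A :: Γ) φ φ' .prop → EqTm Ξ Γ (all A φ) (all A φ') .prop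
  | ex_congr {Ξ : ℕ} {Γ : Ctx} {φ φ' : Tm} {A : Ty} :
      IsTp .L Ξ A → EqTm Ξ (A :: Γ) φ φ' .prop → EqTm Ξ Γ (ex A φ) (ex A φ') .prop
  | sep_congr {Ξ : ℕ} {Γ : Ctx} {φ φ' ψ ψ' : Tm} :
      EqTm Ξ Γ φ φ' .prop → EqTm Ξ Γ ψ ψ' .prop → EqTm Ξ Γ (sep φ ψ) (sep φ' ψ') .prop
  | wand_congr {Ξ : ℕ} {Γ : Ctx} {φ φ' ψ ψ' : Tm} :
      EqTm Ξ Γ φ φ' .prop → EqTm Ξ Γ ψ ψ' .prop → EqTm Ξ Γ (wand φ ψ) (wand φ' ψ') .prop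
  | box_congr {Ξ : ℕ} {Γ : Ctx} {φ φ' : Tm} :
      EqTm Ξ Γ φ φ' .prop → EqTm Ξ Γ (box φ) (box φ') .prop
  | later_congr {Ξ : ℕ} {Γ : Ctx} {φ φ' : Tm} :
      EqTm Ξ Γ φ φ' .prop → EqTm Ξ Γ (later φ) (later φ') .prop
  | pts_congr {Ξ : ℕ} {Γ : Ctx} {l l' u u' : Tm} {A : Ty} :
      EqTm Ξ Γ l l' (.ref A) → EqTm Ξ Γ u u' A → EqTm Ξ Γ (pts l u) (pts l' u') .prop
  | wp_congr {Ξ : ℕ} {Γ : Ctx} {e e' φ φ' : Tm} {A : Ty} :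
      EqTm Ξ Γ e e' (.mon A) → EqTm Ξ (A :: Γ) φ φ' .prop → EqTm Ξ Γ (wp e φ) (wp e' φ') .prop
  -- universal properties of finite products and function spaces
  | unit_eta {Ξ : ℕ} {Γ : Ctx} {u : Tm} : HasType Ξ Γ u .unit → EqTm Ξ Γ u tt .unit
  | fst_pair {Ξ : ℕ} {Γ : Ctx} {u v : Tm} {A B : Ty} :
      HasType Ξ Γ u A → HasType Ξ Γ v B → EqTm Ξ Γ (fst (pair u v)) u A
  | snd_pair {Ξ : ℕ} {Γ : Ctx} {u v : Tm} {A B : Ty} :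
      HasType Ξ Γ u A → HasType Ξ Γ v B → EqTm Ξ Γ (snd (pair u v)) v B
  | prod_eta {Ξ : ℕ} {Γ : Ctx} {u : Tm} {A B : Ty} :
      HasType Ξ Γ u (.prod A B) → EqTm Ξ Γ u (pair (fst u) (snd u)) (.prod A B)
  | arr_beta {Ξ : ℕ} {Γ : Ctx} {u v : Tm} {A B : Ty} :
      IsTp .L Ξ A → HasType Ξ (A :: Γ) u B → HasType Ξ Γ v A →
      EqTm Ξ Γ (app (lam A u) v) (u.inst v) B
  | arr_eta {Ξ : ℕ} {Γ : Ctx} {u : Tm} {A B : Ty} :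
      IsTp .L Ξ A → HasType Ξ Γ u (.arr A B) →
      EqTm Ξ Γ u (lam A (app u.shift (var 0))) (.arr A B)
  -- universal properties of finite sums
  | empty_eta {Ξ : ℕ} {Γ : Ctx} {h u : Tm} {C : Ty} :
      IsTp .L Ξ C → HasType Ξ Γ h (.arr .empty C) → HasType Ξ Γ u .empty →
      EqTm Ξ Γ (app h u) (absurd C u) C
  | case_inl {Ξ : ℕ} {Γ : Ctx} {u v w : Tm} {A B C : Ty} :
      IsTp .L Ξ B → HasType Ξ Γ u A → HasType Ξ (A :: Γ) v C → HasType Ξ (B :: Γ) w C →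
      EqTm Ξ Γ (case (inl B u) v w) (v.inst u) C
  | case_inr {Ξ : ℕ} {Γ : Ctx} {u v w : Tm} {A B C : Ty} :
      IsTp .L Ξ A → HasType Ξ Γ u B → HasType Ξ (A :: Γ) v C → HasType Ξ (B :: Γ) w C →
      EqTm Ξ Γ (case (inr A u) v w) (w.inst u) C
  | sum_eta {Ξ : ℕ} {Γ : Ctx} {h u : Tm} {A B C : Ty} :
      IsTp .L Ξ A → IsTp .L Ξ B →
      HasType Ξ Γ h (.arr (.sum A B) C) → HasType Ξ Γ u (.sum A B) →
      EqTm Ξ Γ (app h u)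
        (case u (app h.shift (inl B (var 0))) (app h.shift (inr A (var 0)))) C
  -- universal property of inductive types: existence and uniqueness of recursive functions
  | iter_con {Ξ : ℕ} {Γ : Ctx} {e u : Tm} {F C : Ty} :
      IsTp .L Ξ (.ind F) → IsTp .L Ξ C → HasType Ξ Γ e (.arr (F.inst C) C) →
      HasType Ξ Γ u (F.inst (.ind F)) →
      EqTm Ξ Γ (iter F C e (con F u))
        (app e (map C F (lam (.ind F) (iter F C e.shift (var 0))) u)) C
  | iter_eta {Ξ : ℕ} {Γ : Ctx} {e h : Tm} {F C : Ty} :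
      IsTp .L Ξ (.ind F) → IsTp .L Ξ C → HasType Ξ Γ e (.arr (F.inst C) C) →
      HasType Ξ Γ h (.arr (.ind F) C) →
      EqTm Ξ (F.inst (.ind F) :: Γ) (app h.shift (con F (var 0)))
        (app e.shift (map C F h.shift (var 0))) C →
      EqTm Ξ Γ h (lam (.ind F) (iter F C e.shift (var 0))) (.arr (.ind F) C)
  -- universal and existential types
  | all_beta {Ξ : ℕ} {Γ : Ctx} {u : Tm} {A B : Ty} :
      HasType (Ξ + 1) (Γ.map Ty.shift) u A → IsTp .P Ξ B →
      EqTm Ξ Γ (tapp (tlam u) B) (u.tinst B) (A.inst B)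
  | all_eta {Ξ : ℕ} {Γ : Ctx} {u : Tm} {A : Ty} :
      HasType Ξ Γ u (.all A) → EqTm Ξ Γ u (tlam (tapp u.tshift (.var 0))) (.all A)
  | ex_beta {Ξ : ℕ} {Γ : Ctx} {u v : Tm} {A B C : Ty} :
      IsTp .P Ξ B → IsTp .P Ξ C → IsTp .P (Ξ + 1) A → HasType Ξ Γ u (A.inst B) →
      HasType (Ξ + 1) (A :: Γ.map Ty.shift) v C.shift →
      EqTm Ξ Γ (unpack (pack A B u) v) ((v.tinst B).inst u) C
  | ex_eta {Ξ : ℕ} {Γ : Ctx} {u v : Tm} {A C : Ty} :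
      IsTp .P Ξ C → HasType Ξ (.ex A :: Γ) u C → HasType Ξ Γ v (.ex A) →
      EqTm Ξ Γ (u.inst v)
        (unpack v (u.tshift.subst fun
          | 0 => pack (A.rename (liftRen Nat.succ)) (.var 0) (var 0)
          | i + 1 => var (i + 1))) C
  -- the monad laws
  | bind_ret {Ξ : ℕ} {Γ : Ctx} {u v : Tm} {A B : Ty} :
      IsTp .P Ξ A → HasType Ξ Γ u A → HasType Ξ (A :: Γ) v (.mon B) →
      EqTm Ξ Γ (bind (ret u) v) (v.inst u) (.mon B)
  | ret_bind {Ξ : ℕ} {Γ : Ctx} {u : Tm} {A : Ty} :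
      HasType Ξ Γ u (.mon A) → EqTm Ξ Γ (bind u (ret (var 0))) u (.mon A)
  | bind_bind {Ξ : ℕ} {Γ : Ctx} {u v w : Tm} {A B C : Ty} :
      HasType Ξ Γ u (.mon A) → HasType Ξ (A :: Γ) v (.mon B) → HasType Ξ (B :: Γ) w (.mon C) →
      EqTm Ξ Γ (bind (bind u v) w) (bind u (bind v w.shift₁)) (.mon C)
  -- recursive types and the store
  | unfold_of_fold {Ξ : ℕ} {Γ : Ctx} {u : Tm} {A : Ty} :
      IsTp .P (Ξ + 1) A → HasType Ξ Γ u (A.inst (.mu A)) →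
      EqTm Ξ Γ (unfold (fold A u)) (seq step (ret u)) (.mon (A.inst (.mu A)))
  | fold_of_unfold {Ξ : ℕ} {Γ : Ctx} {u : Tm} {A : Ty} :
      HasType Ξ Γ u (.mu A) →
      EqTm Ξ Γ (bind (unfold u) (ret (fold A (var 0)))) (seq step (ret u)) (.mon (.mu A))
  | get_after_set {Ξ : ℕ} {Γ : Ctx} {u v : Tm} {A : Ty} :
      HasType Ξ Γ u (.ref A) → HasType Ξ Γ v A →
      EqTm Ξ Γ (seq (set u v) (get u)) (seq step (seq (set u v) (ret v))) (.mon A)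
  | set_after_new {Ξ : ℕ} {Γ : Ctx} {u v w : Tm} {A B : Ty} :
      IsTp .P Ξ A → HasType Ξ Γ u A → HasType Ξ Γ v A →
      HasType Ξ (.ref A :: Γ) w (.mon B) →
      EqTm Ξ Γ (bind (new u) (seq (set (var 0) v.shift) w)) (bind (new v) w) (.mon B)
  | set_after_set {Ξ : ℕ} {Γ : Ctx} {u v w : Tm} {A : Ty} :
      HasType Ξ Γ u (.ref A) → HasType Ξ Γ v A → HasType Ξ Γ w A →
      EqTm Ξ Γ (seq (set u v) (set u w)) (set u w) (.mon .unit)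
  | get_after_get {Ξ : ℕ} {Γ : Ctx} {u v w : Tm} {A B C : Ty} :
      HasType Ξ Γ u (.ref A) → HasType Ξ Γ v (.ref B) → HasType Ξ (B :: A :: Γ) w (.mon C) →
      EqTm Ξ Γ (bind (get u) (bind (get v.shift) w))
        (bind (get v) (bind (get u.shift) (w.rename fun
          | 0 => 1
          | 1 => 0
          | i + 2 => i + 2))) (.mon C)
  | set_after_get {Ξ : ℕ} {Γ : Ctx} {u w : Tm} {A B : Ty} :
      HasType Ξ Γ u (.ref A) → HasType Ξ (A :: Γ) w (.mon B) →
      EqTm Ξ Γ (bind (get u) (seq (set u.shift (var 0)) w)) (bind (get u) w) (.mon B)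
  | step_unfold {Ξ : ℕ} {Γ : Ctx} {u : Tm} {A : Ty} :
      HasType Ξ Γ u (.mu A) →
      EqTm Ξ Γ (seq step (unfold u)) (bind (unfold u) (seq step (ret (var 0))))
        (.mon (A.inst (.mu A)))
  | step_get {Ξ : ℕ} {Γ : Ctx} {u : Tm} {A : Ty} :
      HasType Ξ Γ u (.ref A) →
      EqTm Ξ Γ (seq step (get u)) (bind (get u) (seq step (ret (var 0)))) (.mon A)
  | step_set {Ξ : ℕ} {Γ : Ctx} {u v : Tm} {A : Ty} :
      HasType Ξ Γ u (.ref A) → HasType Ξ Γ v A →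
      EqTm Ξ Γ (seq step (set u v)) (bind (set u v) (seq step (ret (var 0)))) (.mon .unit)
  | step_new {Ξ : ℕ} {Γ : Ctx} {u : Tm} {A : Ty} :
      IsTp .P Ξ A → HasType Ξ Γ u A →
      EqTm Ξ Γ (seq step (new u)) (bind (new u) (seq step (ret (var 0)))) (.mon (.ref A))
  | reflection {Ξ : ℕ} {Γ : Ctx} {u v : Tm} {A : Ty} :
      Entails Ξ Γ top (eq A u v) → EqTm Ξ Γ u v A

/-- `Entails Ξ Γ φ ψ` is the derivability of the sequent `Ξ ∣ Γ ∣ φ ⊢ ψ`. -/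
inductive Entails : ℕ → Ctx → Tm → Tm → Prop
  -- structural rules
  | conv {Ξ : ℕ} {Γ : Ctx} {φ ψ : Tm} : EqTm Ξ Γ φ ψ .prop → Entails Ξ Γ φ ψ
  | cut {Ξ : ℕ} {Γ : Ctx} {φ ψ χ : Tm} :
      Entails Ξ Γ φ ψ → Entails Ξ Γ ψ χ → Entails Ξ Γ φ χ
  | subst {Ξ : ℕ} {Γ Δ : Ctx} {σ : ℕ → Tm} {φ ψ : Tm} :
      IsCtx Ξ Γ → IsCtx Ξ Δ → IsSubst Ξ Γ σ Δ → Entails Ξ Δ φ ψ →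
      Entails Ξ Γ (φ.subst σ) (ψ.subst σ)
  | tsubst {Ξ Θ : ℕ} {Γ : Ctx} {τ : ℕ → Ty} {φ ψ : Tm} :
      IsCtx Θ Γ → IsTySubst Ξ τ Θ → Entails Θ Γ φ ψ →
      Entails Ξ (Γ.map fun B => B.subst τ) (φ.tsubst τ) (ψ.tsubst τ)
  -- intuitionistic higher-order logic
  | top_intro {Ξ : ℕ} {Γ : Ctx} {φ : Tm} : HasType Ξ Γ φ .prop → Entails Ξ Γ φ top
  | bot_elim {Ξ : ℕ} {Γ : Ctx} {φ : Tm} : HasType Ξ Γ φ .prop → Entails Ξ Γ bot φ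
  | and_intro {Ξ : ℕ} {Γ : Ctx} {χ φ ψ : Tm} :
      Entails Ξ Γ χ φ → Entails Ξ Γ χ ψ → Entails Ξ Γ χ (and φ ψ)
  | and_left {Ξ : ℕ} {Γ : Ctx} {φ ψ : Tm} :
      HasType Ξ Γ φ .prop → HasType Ξ Γ ψ .prop → Entails Ξ Γ (and φ ψ) φ
  | and_right {Ξ : ℕ} {Γ : Ctx} {φ ψ : Tm} :
      HasType Ξ Γ φ .prop → HasType Ξ Γ ψ .prop → Entails Ξ Γ (and φ ψ) ψ
  | or_left {Ξ : ℕ} {Γ : Ctx} {φ ψ : Tm} :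
      HasType Ξ Γ φ .prop → HasType Ξ Γ ψ .prop → Entails Ξ Γ φ (or φ ψ)
  | or_right {Ξ : ℕ} {Γ : Ctx} {φ ψ : Tm} :
      HasType Ξ Γ φ .prop → HasType Ξ Γ ψ .prop → Entails Ξ Γ ψ (or φ ψ)
  | or_elim {Ξ : ℕ} {Γ : Ctx} {φ ψ χ : Tm} :
      Entails Ξ Γ φ χ → Entails Ξ Γ ψ χ → Entails Ξ Γ (or φ ψ) χ
  | imp_intro {Ξ : ℕ} {Γ : Ctx} {χ φ ψ : Tm} :
      Entails Ξ Γ (and χ φ) ψ → Entails Ξ Γ χ (imp φ ψ)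
  | imp_elim {Ξ : ℕ} {Γ : Ctx} {χ φ ψ : Tm} :
      Entails Ξ Γ χ (imp φ ψ) → Entails Ξ Γ (and χ φ) ψ
  | all_intro {Ξ : ℕ} {Γ : Ctx} {χ φ : Tm} {A : Ty} :
      IsTp .L Ξ A → HasType Ξ Γ χ .prop → Entails Ξ (A :: Γ) χ.shift φ →
      Entails Ξ Γ χ (all A φ)
  | all_elim {Ξ : ℕ} {Γ : Ctx} {φ u : Tm} {A : Ty} :
      IsTp .L Ξ A → HasType Ξ (A :: Γ) φ .prop → HasType Ξ Γ u A →
      Entails Ξ Γ (all A φ) (φ.inst u)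
  | ex_intro {Ξ : ℕ} {Γ : Ctx} {φ u : Tm} {A : Ty} :
      IsTp .L Ξ A → HasType Ξ (A :: Γ) φ .prop → HasType Ξ Γ u A →
      Entails Ξ Γ (φ.inst u) (ex A φ)
  | ex_elim {Ξ : ℕ} {Γ : Ctx} {χ φ : Tm} {A : Ty} :
      IsTp .L Ξ A → HasType Ξ Γ χ .prop → Entails Ξ (A :: Γ) φ χ.shift →
      Entails Ξ Γ (ex A φ) χ
  | lawvere {Ξ : ℕ} {Γ : Ctx} {φ ψ : Tm} {A : Ty} :
      IsTp .L Ξ A → HasType Ξ (A :: A :: Γ) φ .prop → HasType Ξ (A :: A :: Γ) ψ .prop →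
      Entails Ξ (A :: Γ) (φ.inst (var 0)) (ψ.inst (var 0)) →
      Entails Ξ (A :: A :: Γ) (and φ (eq A (var 1) (var 0))) ψ
  | lawvere_inv {Ξ : ℕ} {Γ : Ctx} {φ ψ : Tm} {A : Ty} :
      IsTp .L Ξ A → HasType Ξ (A :: A :: Γ) φ .prop → HasType Ξ (A :: A :: Γ) ψ .prop →
      Entails Ξ (A :: A :: Γ) (and φ (eq A (var 1) (var 0))) ψ →
      Entails Ξ (A :: Γ) (φ.inst (var 0)) (ψ.inst (var 0))
  | prop_ext {Ξ : ℕ} {Γ : Ctx} {χ φ ψ : Tm} :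
      Entails Ξ Γ (and χ φ) ψ → Entails Ξ Γ (and χ ψ) φ → Entails Ξ Γ χ (eq .prop φ ψ)
  | induction {Ξ : ℕ} {Γ : Ctx} {χ P : Tm} {F : Ty} :
      IsTp .L Ξ (.ind F) → HasType Ξ Γ χ .prop → HasType Ξ Γ P (.arr (.ind F) .prop) →
      Entails Ξ (F.inst (.ind F) :: Γ) (and χ.shift (lift (.ind F) F P.shift (var 0)))
        (app P.shift (con F (var 0))) →
      Entails Ξ (.ind F :: Γ) χ.shift (app P.shift (var 0))
  -- affine separation logic
  | wand_intro {Ξ : ℕ} {Γ : Ctx} {χ φ ψ : Tm} :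
      Entails Ξ Γ (sep χ φ) ψ → Entails Ξ Γ χ (wand φ ψ)
  | wand_elim {Ξ : ℕ} {Γ : Ctx} {χ φ ψ : Tm} :
      Entails Ξ Γ χ (wand φ ψ) → Entails Ξ Γ (sep χ φ) ψ
  | sep_mono {Ξ : ℕ} {Γ : Ctx} {φ φ' ψ ψ' : Tm} :
      Entails Ξ Γ φ φ' → Entails Ξ Γ ψ ψ' → Entails Ξ Γ (sep φ ψ) (sep φ' ψ')
  | sep_and {Ξ : ℕ} {Γ : Ctx} {φ ψ : Tm} :
      HasType Ξ Γ φ .prop → HasType Ξ Γ ψ .prop → Entails Ξ Γ (sep φ ψ) (and φ ψ)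
  | sep_top {Ξ : ℕ} {Γ : Ctx} {φ : Tm} :
      HasType Ξ Γ φ .prop → Entails Ξ Γ φ (sep φ top)
  | sep_assoc {Ξ : ℕ} {Γ : Ctx} {χ φ ψ : Tm} :
      HasType Ξ Γ χ .prop → HasType Ξ Γ φ .prop → HasType Ξ Γ ψ .prop →
      Entails Ξ Γ (sep (sep χ φ) ψ) (sep χ (sep φ ψ))
  | sep_assoc_inv {Ξ : ℕ} {Γ : Ctx} {χ φ ψ : Tm} :
      HasType Ξ Γ χ .prop → HasType Ξ Γ φ .prop → HasType Ξ Γ ψ .prop →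
      Entails Ξ Γ (sep χ (sep φ ψ)) (sep (sep χ φ) ψ)
  | sep_comm {Ξ : ℕ} {Γ : Ctx} {φ ψ : Tm} :
      HasType Ξ Γ φ .prop → HasType Ξ Γ ψ .prop → Entails Ξ Γ (sep φ ψ) (sep ψ φ)
  -- persistence
  | box_mono {Ξ : ℕ} {Γ : Ctx} {φ ψ : Tm} : Entails Ξ Γ φ ψ → Entails Ξ Γ (box φ) (box ψ)
  | box_dup {Ξ : ℕ} {Γ : Ctx} {φ : Tm} :
      HasType Ξ Γ φ .prop → Entails Ξ Γ (box φ) (sep φ (box φ))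
  | box_idem {Ξ : ℕ} {Γ : Ctx} {φ : Tm} :
      HasType Ξ Γ φ .prop → Entails Ξ Γ (box φ) (box (box φ))
  | and_box {Ξ : ℕ} {Γ : Ctx} {φ ψ : Tm} :
      HasType Ξ Γ φ .prop → HasType Ξ Γ ψ .prop →
      Entails Ξ Γ (and φ (box ψ)) (sep φ (box ψ))
  | box_top {Ξ : ℕ} {Γ : Ctx} : Entails Ξ Γ top (box top)
  | box_and {Ξ : ℕ} {Γ : Ctx} {φ ψ : Tm} :
      HasType Ξ Γ φ .prop → HasType Ξ Γ ψ .prop →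
      Entails Ξ Γ (and (box φ) (box ψ)) (box (and φ ψ))
  | box_imp {Ξ : ℕ} {Γ : Ctx} {φ ψ : Tm} :
      HasType Ξ Γ φ .prop → HasType Ξ Γ ψ .prop →
      Entails Ξ Γ (imp (box φ) (box ψ)) (box (imp (box φ) (box ψ)))
  | box_all {Ξ : ℕ} {Γ : Ctx} {φ : Tm} {A : Ty} :
      IsTp .L Ξ A → HasType Ξ (A :: Γ) φ .prop →
      Entails Ξ Γ (all A (box φ)) (box (all A φ))
  -- the later modality
  | later_intro {Ξ : ℕ} {Γ : Ctx} {φ : Tm} :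
      HasType Ξ Γ φ .prop → Entails Ξ Γ φ (later φ)
  | later_and {Ξ : ℕ} {Γ : Ctx} {φ ψ : Tm} :
      HasType Ξ Γ φ .prop → HasType Ξ Γ ψ .prop →
      Entails Ξ Γ (and (later φ) (later ψ)) (later (and φ ψ))
  | later_sep {Ξ : ℕ} {Γ : Ctx} {φ ψ : Tm} :
      HasType Ξ Γ φ .prop → HasType Ξ Γ ψ .prop →
      Entails Ξ Γ (sep (later φ) (later ψ)) (later (sep φ ψ))
  | later_wand {Ξ : ℕ} {Γ : Ctx} {φ ψ : Tm} :
      HasType Ξ Γ φ .prop → HasType Ξ Γ ψ .prop →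
      Entails Ξ Γ (wand φ ψ) (wand (later φ) (later ψ))
  | later_box {Ξ : ℕ} {Γ : Ctx} {φ : Tm} :
      HasType Ξ Γ φ .prop → Entails Ξ Γ (later (box φ)) (box (later φ))
  | box_later {Ξ : ℕ} {Γ : Ctx} {φ : Tm} :
      HasType Ξ Γ φ .prop → Entails Ξ Γ (box (later φ)) (later (box φ))
  | fold_equality {Ξ : ℕ} {Γ : Ctx} {φ u v : Tm} {A : Ty} :
      IsTp .P (Ξ + 1) A → HasType Ξ Γ u (A.inst (.mu A)) → HasType Ξ Γ v (A.inst (.mu A)) →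
      Entails Ξ Γ φ (later (eq (A.inst (.mu A)) u v)) →
      Entails Ξ Γ φ (eq (.mu A) (fold A u) (fold A v))
  | fold_equality_inv {Ξ : ℕ} {Γ : Ctx} {φ u v : Tm} {A : Ty} :
      IsTp .P (Ξ + 1) A → HasType Ξ Γ u (A.inst (.mu A)) → HasType Ξ Γ v (A.inst (.mu A)) →
      Entails Ξ Γ φ (eq (.mu A) (fold A u) (fold A v)) →
      Entails Ξ Γ φ (later (eq (A.inst (.mu A)) u v))
  | step_equality {Ξ : ℕ} {Γ : Ctx} {φ u v : Tm} {A : Ty} :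
      IsTp .P Ξ A → HasType Ξ Γ u (.mon A) → HasType Ξ Γ v (.mon A) →
      Entails Ξ Γ φ (later (eq (.mon A) u v)) →
      Entails Ξ Γ φ (eq (.mon A) (seq step u) (seq step v))
  | step_equality_inv {Ξ : ℕ} {Γ : Ctx} {φ u v : Tm} {A : Ty} :
      IsTp .P Ξ A → HasType Ξ Γ u (.mon A) → HasType Ξ Γ v (.mon A) →
      Entails Ξ Γ φ (eq (.mon A) (seq step u) (seq step v)) →
      Entails Ξ Γ φ (later (eq (.mon A) u v))
  | loeb {Ξ : ℕ} {Γ : Ctx} {φ : Tm} :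
      HasType Ξ Γ φ .prop → Entails Ξ Γ (imp (later φ) φ) φ
  -- weakest preconditions
  | wp_wand {Ξ : ℕ} {Γ : Ctx} {e φ ψ : Tm} {A : Ty} :
      IsTp .P Ξ A → HasType Ξ Γ e (.mon A) → HasType Ξ (A :: Γ) φ .prop →
      HasType Ξ (A :: Γ) ψ .prop →
      Entails Ξ Γ (sep (all A (wand φ ψ)) (wp e φ)) (wp e ψ)
  | wp_val {Ξ : ℕ} {Γ : Ctx} {e φ : Tm} {A : Ty} :
      IsTp .P Ξ A → HasType Ξ Γ e A → HasType Ξ (A :: Γ) φ .prop →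
      Entails Ξ Γ (φ.inst e) (wp (ret e) φ)
  | wp_bind {Ξ : ℕ} {Γ : Ctx} {e₁ e₂ φ : Tm} {A B : Ty} :
      HasType Ξ Γ e₁ (.mon A) → HasType Ξ (A :: Γ) e₂ (.mon B) → HasType Ξ (B :: Γ) φ .prop →
      Entails Ξ Γ (wp e₁ (wp e₂ φ.shift₁)) (wp (bind e₁ e₂) φ)
  | wp_get {Ξ : ℕ} {Γ : Ctx} {l φ : Tm} {A : Ty} :
      IsTp .P Ξ A → HasType Ξ Γ l (.ref A) → HasType Ξ (A :: Γ) φ .prop →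
      Entails Ξ Γ
        (ex A (sep (pts l.shift (var 0)) (later (wand (pts l.shift (var 0)) φ))))
        (wp (get l) φ)
  | wp_set {Ξ : ℕ} {Γ : Ctx} {l e φ : Tm} {A : Ty} :
      IsTp .P Ξ A → HasType Ξ Γ l (.ref A) → HasType Ξ Γ e A → HasType Ξ Γ φ .prop →
      Entails Ξ Γ (sep (ex A (pts l.shift (var 0))) (wand (pts l e) φ))
        (wp (set l e) φ.shift)
  | wp_new {Ξ : ℕ} {Γ : Ctx} {e φ : Tm} {A : Ty} :
      IsTp .P Ξ A → HasType Ξ Γ e A → HasType Ξ (.ref A :: Γ) φ .prop →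
      Entails Ξ Γ (all (.ref A) (wand (pts (var 0) e.shift) φ)) (wp (new e) φ)
  | wp_step {Ξ : ℕ} {Γ : Ctx} {φ : Tm} :
      HasType Ξ Γ φ .prop → Entails Ξ Γ (later φ) (wp step φ.shift)

end

/-! ## Recursive functions

`rec f x. e` is derived from recursive types through the self-referential type
`S = μ σ. σ → A → T B`. -/

namespace Tm

def selfTy (A B : Ty) : Ty := .arr (.var 0) (.arr A.shift (.mon B.shift))

/-- `λ x : A. (g ← unfold s; g s x)`, for `s : S`. -/
def unroll (A : Ty) (s : Tm) : Tm :=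
  lam A (bind (unfold s.shift) (app (app (var 0) s.shift.shift) (var 1)))

/-- `rec f x. e : A → T B`, where `x` is variable `0` and `f` is variable `1` of `e`: with
`w = λ (s : S) (x : A). e[unroll s / f]`, this is `unroll (fold w)`. -/
def recFun (A B : Ty) (e : Tm) : Tm :=
  unroll A (fold (selfTy A B) (lam (.mu (selfTy A B)) (lam A (e.subst fun
    | 0 => var 0
    | 1 => unroll A (var 1)
    | i + 2 => var (i + 2)))))

end Tm

/-! ## Functional and imperative linked lists -/

/-- The functor of which functional lists on `A` are the inductive type. -/
def listF (A : Ty) : Ty := .sum .unit (.prod A.shift (.var 0))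

/-- Functional lists on `A`. -/
def list (A : Ty) : Ty := .ind (listF A)

/-- The functor of which imperative linked lists on `A` are the recursive type. -/
def llistF (A : Ty) : Ty := .sum .unit (.ref (.prod A.shift (.var 0)))

/-- Imperative linked lists on `A`: the type `μ ρ. 1 + ref (A × ρ)`. -/
def llist (A : Ty) : Ty := .mu (llistF A)

namespace Tm

def nil (A : Ty) : Tm := con (listF A) (inl (.prod A (list A)) tt)

def cons (A : Ty) (x xs : Tm) : Tm := con (listF A) (inr .unit (pair x xs))

/-- `fold (inl ())` -/
def lnil (A : Ty) : Tm := fold (llistF A) (inl (.ref (.prod A (llist A))) tt)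

/-- `fold (inr r)` -/
def lcons (A : Ty) (r : Tm) : Tm := fold (llistF A) (inr .unit r)

/-- The list invariant `l ≈ u`, by structural recursion on the functional list `u`:
`l ≈ nil` is `l = fold (inl ())`, and `l ≈ cons x xs` is
`∃ r l'. l = fold (inr r) ∗ r ↦ (x, l') ∗ l' ≈ xs`. -/
def listInv (A : Ty) (l u : Tm) : Tm :=
  app (iter (listF A) (.arr (llist A) .prop)
    (lam (.sum .unit (.prod A (.arr (llist A) .prop)))
      (case (var 0)
        (lam (llist A) (eq (llist A) (var 0) (lnil A)))
        -- variable 1 is the pair of `x` and of the predicate `(- ≈ xs)`, variable 0 is `l`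
        (lam (llist A)
          -- variable 3 is that pair, variable 2 is `l`, variable 1 is `r`, variable 0 is `l'`
          (ex (.ref (.prod A (llist A))) (ex (llist A)
            (sep (eq (llist A) (var 2) (lcons A (var 1)))
              (sep (pts (var 1) (pair (fst (var 3)) (var 0)))
                (app (snd (var 3)) (var 0)))))))))
    u) l

/-- Append of functional lists, by structural recursion on `xs`:
`nil ⊕ ys = ys` and `cons x xs ⊕ ys = cons x (xs ⊕ ys)`. -/
def append (A : Ty) (xs ys : Tm) : Tm :=
  iter (listF A) (list A)
    (lam (.sum .unit (.prod A (list A)))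
      (case (var 0) ys.shift.shift (cons A (fst (var 0)) (snd (var 0)))))
    xs

/-- Append of imperative linked lists, of type `llist A × llist A → T (llist A)`:
`rec f (l₁, l₂). z ← unfold l₁; match z with inl _ ⇒ ret l₂ |`
`inr r ⇒ (a, l₁') ← get r; l₃ ← f (l₁', l₂); set r (a, l₃); ret (fold (inr r))`. -/
def lappend (A : Ty) : Tm :=
  recFun (.prod (llist A) (llist A)) (llist A)
    -- variables: 0 is `(l₁, l₂)`, 1 is `f`
    (bind (unfold (fst (var 0)))
      -- variables: 0 is `z`, 1 is `(l₁, l₂)`, 2 is `f`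
      (case (var 0)
        -- variables: 2 is `(l₁, l₂)`
        (ret (snd (var 2)))
        -- variables: 0 is `r`, 2 is `(l₁, l₂)`, 3 is `f`
        (bind (get (var 0))
          -- variables: 0 is `(a, l₁')`, 1 is `r`, 3 is `(l₁, l₂)`, 4 is `f`
          (bind (app (var 4) (pair (snd (var 0)) (snd (var 3))))
            -- variables: 0 is `l₃`, 1 is `(a, l₁')`, 2 is `r`
            (seq (set (var 2) (pair (fst (var 1)) (var 0)))
              (ret (lcons A (var 2))))))))

end Tm

end LMuRef

namespace LMuRef

/-! ## Deciding well-formedness, typing and β-conversion -/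

namespace Ty

-- The specification is proved by structural induction on the functional list `u₁`, with `u₂`, `l₁`,
-- `l₂` universally quantified inside the induction predicate `appendSpec`. Generalising `l₁` is
-- essential, because the recursive call runs on the tail of the first linked list. Löb induction is
-- never needed: the recursion of the program follows the structure of `u₁`, so every later modality
-- is discharged by `φ ⊢ ▹ φ`.
--
-- For the empty list, the invariant says that `l₁` is `fold (inl ())`, and the program is
-- judgmentally `step; step; ret l₂`; the required postcondition is the invariant of `l₂`
-- (`appendTriple_nil`). For a nonempty list, the invariant provides a reference `r` that holds the
-- head and a tail `l'`. The program is `step; step` followed by the read, the recursive call and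
-- the write (`lappend_lcons`). The cell at `r` is framed around the recursive call, to which the
-- induction hypothesis applies; the write then stores the new tail in `r`, and the invariant is
-- closed again with the same `r` (`wp_set_lcons`, `wp_lappend_lcons`, `appendTriple_cons`). The
-- induction hypothesis is consumed exactly once, so it is treated as an ordinary separating
-- conjunct and persistence plays no role.
--
-- The rest is bookkeeping in the object syntax. The proof fixes concrete de Bruijn terms, so
-- typing, formation and β-equality are settled by verified boolean tests (`infer_sound`,
-- `conv_sound`) evaluated in the kernel. This replaces a metatheory of substitution: no weakening,
-- substitution or subject reduction lemma is proved, and general rules take the typings of weakened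
-- terms as hypotheses.

def beq : Ty → Ty → Bool
  | var i, var j => i == j
  | unit, unit => true
  | prod A B, prod A' B' => beq A A' && beq B B'
  | arr A B, arr A' B' => beq A A' && beq B B'
  | empty, empty => true
  | sum A B, sum A' B' => beq A A' && beq B B'
  | ind F, ind F' => beq F F'
  | all A, all A' => beq A A'
  | ex A, ex A' => beq A A'
  | mon A, mon A' => beq A A'
  | mu A, mu A' => beq A A'
  | ref A, ref A' => beq A A'
  | prop, prop => true
  | _, _ => false

theorem eq_of_beq {A B : Ty} (h : beq A B = true) : A = B := by
  induction A generalizing B <;> cases B <;> simp_all [beq] <;> aesop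

theorem beq_refl (A : Ty) : beq A A = true := by
  induction A <;> simp_all [beq]

instance : DecidableEq Ty := fun A B =>
  if h : beq A B = true then isTrue (eq_of_beq h)
  else isFalse fun e => h (e ▸ beq_refl A)

/-- A test that is sufficient for `SPos`. -/
def spos : Ty → Bool
  | var _ => true
  | unit => true
  | prod F G => spos F && spos G
  | sum F G => spos F && spos G
  | _ => false

theorem spos_sound {F : Ty} (h : spos F = true) : SPos F := by
  induction F with
  | var i =>
    cases i with
    | zero => exact .self
    -- A variable other than the recursion variable is the weakening of a variable, hence a constant
    -- type.
    | succ i => exact .const (.var i)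
  | unit => exact .const .unit
  | prod F G hF hG => simp only [spos, Bool.and_eq_true] at h; exact .prod (hF h.1) (hG h.2)
  | sum F G hF hG => simp only [spos, Bool.and_eq_true] at h; exact .sum (hF h.1) (hG h.2)
  | _ => simp [spos] at h

/-- A test that is sufficient for `IsTp .P`. -/
def program (Ξ : ℕ) : Ty → Bool
  | var i => decide (i < Ξ)
  | unit => true
  | prod A B => program Ξ A && program Ξ B
  | arr A B => program Ξ A && program Ξ B
  | empty => true
  | sum A B => program Ξ A && program Ξ B
  | ind F => spos F && program (Ξ + 1) F
  | all A => program (Ξ + 1) A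
  | ex A => program (Ξ + 1) A
  | mon A => program Ξ A
  | mu A => program (Ξ + 1) A
  | ref A => program Ξ A
  | prop => false

theorem program_sound {Ξ : ℕ} {A : Ty} (h : program Ξ A = true) : IsTp .P Ξ A := by
  induction A generalizing Ξ with
  | ind F hF => simp only [program, Bool.and_eq_true] at h; exact .ind (spos_sound h.1) (hF h.2)
  | prop => simp [program] at h
  | _ => simp [program] at h; constructor <;> simp_all

/-- A test that is sufficient for `IsTp .L`. -/
def logical (Ξ : ℕ) : Ty → Bool
  | var i => decide (i < Ξ)
  | unit => true
  | prod A B => logical Ξ A && logical Ξ B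
  | arr A B => logical Ξ A && logical Ξ B
  | empty => true
  | sum A B => logical Ξ A && logical Ξ B
  | ind F => spos F && logical (Ξ + 1) F
  | all A => logical (Ξ + 1) A
  | prop => true
  | A => program Ξ A

theorem logical_sound {Ξ : ℕ} {A : Ty} (h : logical Ξ A = true) : IsTp .L Ξ A := by
  induction A generalizing Ξ with
  | ind F hF => simp only [logical, Bool.and_eq_true] at h; exact .ind (spos_sound h.1) (hF h.2)
  | ex A => exact .incl (program_sound h)
  | mon A => exact .incl (program_sound h)
  | mu A => exact .incl (program_sound h)
  | ref A => exact .incl (program_sound h)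
  | prop => exact .prop
  | _ => simp [logical] at h; constructor <;> simp_all

end Ty

theorem IsCtx.of_logical {Ξ : ℕ} {Γ : Ctx} (h : (Γ.all fun A => A.logical Ξ) = true) :
    IsCtx Ξ Γ := fun _ hA => Ty.logical_sound (List.all_eq_true.mp h _ hA)

-- Syntactic equality of terms

namespace Tm

def beq : Tm → Tm → Bool
  | var i, var j => i == j
  | tt, tt => true
  | pair u v, pair u' v' => beq u u' && beq v v'
  | fst u, fst u' => beq u u'
  | snd u, snd u' => beq u u'
  | lam A u, lam A' u' => decide (A = A') && beq u u'
  | app u v, app u' v' => beq u u' && beq v v'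
  | inl B u, inl B' u' => decide (B = B') && beq u u'
  | inr A u, inr A' u' => decide (A = A') && beq u u'
  | case u v w, case u' v' w' => beq u u' && (beq v v' && beq w w')
  | con F u, con F' u' => decide (F = F') && beq u u'
  | iter F C e u, iter F' C' e' u' =>
      decide (F = F') && (decide (C = C') && (beq e e' && beq u u'))
  | ret u, ret u' => beq u u'
  | bind u v, bind u' v' => beq u u' && beq v v'
  | fold A u, fold A' u' => decide (A = A') && beq u u'
  | unfold u, unfold u' => beq u u'
  | get u, get u' => beq u u'
  | set u v, set u' v' => beq u u' && beq v v'
  | new u, new u' => beq u u'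
  | step, step => true
  | eq A u v, eq A' u' v' => decide (A = A') && (beq u u' && beq v v')
  | top, top => true
  | bot, bot => true
  | and φ ψ, and φ' ψ' => beq φ φ' && beq ψ ψ'
  | or φ ψ, or φ' ψ' => beq φ φ' && beq ψ ψ'
  | imp φ ψ, imp φ' ψ' => beq φ φ' && beq ψ ψ'
  | all A φ, all A' φ' => decide (A = A') && beq φ φ'
  | ex A φ, ex A' φ' => decide (A = A') && beq φ φ'
  | sep φ ψ, sep φ' ψ' => beq φ φ' && beq ψ ψ'
  | wand φ ψ, wand φ' ψ' => beq φ φ' && beq ψ ψ'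
  | box φ, box φ' => beq φ φ'
  | later φ, later φ' => beq φ φ'
  | pts l u, pts l' u' => beq l l' && beq u u'
  | wp e φ, wp e' φ' => beq e e' && beq φ φ'
  | _, _ => false

/-- Only soundness matters: the test is allowed to reject equal terms, and does so for the
constructs of universal and existential types. -/
theorem eq_of_beq {u v : Tm} (h : beq u v = true) : u = v := by
  fun_induction beq u v <;> simp_all

end Tm

-- Inversion of typing for introduction forms

theorem HasType.lam_inv {Ξ : ℕ} {Γ : Ctx} {u : Tm} {A A' B : Ty}
    (h : HasType Ξ Γ (.lam A' u) (.arr A B)) :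
    A' = A ∧ IsTp .L Ξ A ∧ HasType Ξ (A :: Γ) u B := by
  cases h with
  | lam hA hu => exact ⟨rfl, hA, hu⟩

theorem HasType.pair_inv {Ξ : ℕ} {Γ : Ctx} {u v : Tm} {A B : Ty}
    (h : HasType Ξ Γ (.pair u v) (.prod A B)) : HasType Ξ Γ u A ∧ HasType Ξ Γ v B := by
  cases h with
  | pair hu hv => exact ⟨hu, hv⟩

theorem HasType.inl_inv {Ξ : ℕ} {Γ : Ctx} {u : Tm} {A B B' : Ty}
    (h : HasType Ξ Γ (.inl B' u) (.sum A B)) : B' = B ∧ IsTp .L Ξ B ∧ HasType Ξ Γ u A := by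
  cases h with
  | inl hB hu => exact ⟨rfl, hB, hu⟩

theorem HasType.inr_inv {Ξ : ℕ} {Γ : Ctx} {u : Tm} {A A' B : Ty}
    (h : HasType Ξ Γ (.inr A' u) (.sum A B)) : A' = A ∧ IsTp .L Ξ A ∧ HasType Ξ Γ u B := by
  cases h with
  | inr hA hu => exact ⟨rfl, hA, hu⟩

theorem HasType.con_inv {Ξ : ℕ} {Γ : Ctx} {u : Tm} {F F' : Ty}
    (h : HasType Ξ Γ (.con F' u) (.ind F)) : F' = F ∧ HasType Ξ Γ u (F.inst (.ind F)) := by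
  cases h with
  | con hF hu => exact ⟨rfl, hu⟩

theorem HasType.ret_inv {Ξ : ℕ} {Γ : Ctx} {u : Tm} {A : Ty}
    (h : HasType Ξ Γ (.ret u) (.mon A)) : IsTp .P Ξ A ∧ HasType Ξ Γ u A := by
  cases h with
  | ret hA hu => exact ⟨hA, hu⟩

-- Type inference

namespace Tm

/-- Type inference, for the fragment without universal and existential types. -/
def infer (Ξ : ℕ) (Γ : Ctx) : Tm → Option Ty
  | var i => Γ[i]?
  | tt => some .unit
  | pair u v =>
    match infer Ξ Γ u, infer Ξ Γ v with
    | some A, some B => some (.prod A B)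
    | _, _ => none
  | fst u =>
    match infer Ξ Γ u with
    | some (.prod A _) => some A
    | _ => none
  | snd u =>
    match infer Ξ Γ u with
    | some (.prod _ B) => some B
    | _ => none
  | lam A u =>
    match infer Ξ (A :: Γ) u with
    | some B => if A.logical Ξ then some (.arr A B) else none
    | _ => none
  | app u v =>
    match infer Ξ Γ u, infer Ξ Γ v with
    | some (.arr A B), some A' => if A' = A then some B else none
    | _, _ => none
  | inl B u =>
    match infer Ξ Γ u with
    | some A => if B.logical Ξ then some (.sum A B) else none
    | _ => none
  | inr A u =>
    match infer Ξ Γ u with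
    | some B => if A.logical Ξ then some (.sum A B) else none
    | _ => none
  | case u v w =>
    match infer Ξ Γ u with
    | some (.sum A B) =>
      match infer Ξ (A :: Γ) v, infer Ξ (B :: Γ) w with
      | some C, some C' => if C' = C then some C else none
      | _, _ => none
    | _ => none
  | con F u =>
    match infer Ξ Γ u with
    | some A =>
      if (Ty.ind F).logical Ξ ∧ A = F.inst (.ind F) then some (.ind F) else none
    | _ => none
  | iter F C e u =>
    match infer Ξ Γ e, infer Ξ Γ u with
    | some A, some B =>
      if (Ty.ind F).logical Ξ ∧ C.logical Ξ ∧ A = .arr (F.inst C) C ∧ B = .ind F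
      then some C else none
    | _, _ => none
  | ret u =>
    match infer Ξ Γ u with
    | some A => if A.program Ξ then some (.mon A) else none
    | _ => none
  | bind u v =>
    match infer Ξ Γ u with
    | some (.mon A) =>
      match infer Ξ (A :: Γ) v with
      | some (.mon B) => some (.mon B)
      | _ => none
    | _ => none
  | fold A u =>
    match infer Ξ Γ u with
    | some B => if A.program (Ξ + 1) ∧ B = A.inst (.mu A) then some (.mu A) else none
    | _ => none
  | unfold u =>
    match infer Ξ Γ u with
    | some (.mu A) => some (.mon (A.inst (.mu A)))
    | _ => none
  | get u =>
    match infer Ξ Γ u with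
    | some (.ref A) => some (.mon A)
    | _ => none
  | set u v =>
    match infer Ξ Γ u, infer Ξ Γ v with
    | some (.ref A), some A' => if A' = A then some (.mon .unit) else none
    | _, _ => none
  | step => some (.mon .unit)
  | eq A u v =>
    match infer Ξ Γ u, infer Ξ Γ v with
    | some B, some C => if A.logical Ξ ∧ B = A ∧ C = A then some .prop else none
    | _, _ => none
  | top => some .prop
  | imp φ ψ =>
    match infer Ξ Γ φ, infer Ξ Γ ψ with
    | some .prop, some .prop => some .prop
    | _, _ => none
  | and φ ψ =>
    match infer Ξ Γ φ, infer Ξ Γ ψ with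
    | some .prop, some .prop => some .prop
    | _, _ => none
  | sep φ ψ =>
    match infer Ξ Γ φ, infer Ξ Γ ψ with
    | some .prop, some .prop => some .prop
    | _, _ => none
  | wand φ ψ =>
    match infer Ξ Γ φ, infer Ξ Γ ψ with
    | some .prop, some .prop => some .prop
    | _, _ => none
  | all A φ =>
    match infer Ξ (A :: Γ) φ with
    | some .prop => if A.logical Ξ then some .prop else none
    | _ => none
  | ex A φ =>
    match infer Ξ (A :: Γ) φ with
    | some .prop => if A.logical Ξ then some .prop else none
    | _ => none
  | later φ =>
    match infer Ξ Γ φ with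
    | some .prop => some .prop
    | _ => none
  | pts l u =>
    match infer Ξ Γ l, infer Ξ Γ u with
    | some (.ref A), some A' => if A' = A then some .prop else none
    | _, _ => none
  | wp e φ =>
    match infer Ξ Γ e with
    | some (.mon A) =>
      match infer Ξ (A :: Γ) φ with
      | some .prop => some .prop
      | _ => none
    | _ => none
  | _ => none

theorem infer_sound {Ξ : ℕ} {Γ : Ctx} {u : Tm} {A : Ty} (h : infer Ξ Γ u = some A) :
    HasType Ξ Γ u A := by
  fun_induction infer Ξ Γ u generalizing A
  all_goals try cases h
  all_goals try simp_all only [Option.some.injEq, forall_eq']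
  case case1 h => exact .var h
  all_goals
    constructor <;>
      first
        | assumption
        | exact Ty.logical_sound (by tauto)
        | exact Ty.program_sound (by tauto)

end Tm

/-- `u` and `v` are well-typed and judgmentally equal. -/
structure Conv (Ξ : ℕ) (Γ : Ctx) (u v : Tm) (A : Ty) : Prop where
  left : HasType Ξ Γ u A
  right : HasType Ξ Γ v A
  eqTm : EqTm Ξ Γ u v A

-- Normalisation by the computation rules

namespace Tm

/-- One β-step at the root of a term. -/
def contract : Tm → Option Tm
  | app (lam _ u) v => some (u.inst v)
  | fst (pair u _) => some u
  | snd (pair _ v) => some v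
  | case (inl _ u) v _ => some (v.inst u)
  | case (inr _ u) _ w => some (w.inst u)
  | iter F C e (con _ u) => some (app e (map C F (lam (.ind F) (iter F C e.shift (var 0))) u))
  | bind (ret u) v => some (v.inst u)
  | _ => none

/-- Each contraction is a computation rule of the equality judgement; inverting the typing of the
introduction form shows that its annotation agrees with the type at which it is eliminated. Typing
of the contractum is deliberately not claimed, as it would require a substitution lemma; `norm`
infers its type afresh. -/
theorem contract_sound {Ξ : ℕ} {Γ : Ctx} {u v : Tm} {A : Ty} (hu : HasType Ξ Γ u A)
    (h : contract u = some v) : EqTm Ξ Γ u v A := by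
  unfold contract at h
  split at h <;> cases h
  · cases hu with
    | app h₁ h₂ =>
      obtain ⟨rfl, hA, h⟩ := h₁.lam_inv
      exact .arr_beta hA h h₂
  · cases hu with
    | fst h => exact .fst_pair h.pair_inv.1 h.pair_inv.2
  · cases hu with
    | snd h => exact .snd_pair h.pair_inv.1 h.pair_inv.2
  · cases hu with
    | case h₁ h₂ h₃ =>
      obtain ⟨rfl, hB, h⟩ := h₁.inl_inv
      exact .case_inl hB h h₂ h₃
  · cases hu with
    | case h₁ h₂ h₃ =>
      obtain ⟨rfl, hA, h⟩ := h₁.inr_inv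
      exact .case_inr hA h h₂ h₃
  · cases hu with
    | iter hF hC he h =>
      obtain ⟨rfl, h⟩ := h.con_inv
      exact .iter_con hF hC he h
  · cases hu with
    | bind h₁ h₂ => exact .bind_ret h₁.ret_inv.1 h₁.ret_inv.2 h₂

/-- Apply `r` to the immediate subterms and infer the type. -/
def normArgs (Ξ : ℕ) (r : Ctx → Tm → Option (Tm × Ty)) (Γ : Ctx) : Tm → Option (Tm × Ty)
  | var i =>
    match Γ[i]? with
    | some .unit => some (tt, .unit)
    | some A => some (var i, A)
    | _ => none
  | tt => some (tt, .unit)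
  | pair u v =>
    match r Γ u, r Γ v with
    | some (u', A), some (v', B) => some (pair u' v', .prod A B)
    | _, _ => none
  | fst u =>
    match r Γ u with
    | some (u', .prod A _) => some (fst u', A)
    | _ => none
  | snd u =>
    match r Γ u with
    | some (u', .prod _ B) => some (snd u', B)
    | _ => none
  | lam A u =>
    match r (A :: Γ) u with
    | some (u', B) => if A.logical Ξ then some (lam A u', .arr A B) else none
    | _ => none
  | app u v =>
    match r Γ u, r Γ v with
    | some (u', .arr A B), some (v', A') => if A' = A then some (app u' v', B) else none
    | _, _ => none
  | inl B u =>
    match r Γ u with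
    | some (u', A) => if B.logical Ξ then some (inl B u', .sum A B) else none
    | _ => none
  | inr A u =>
    match r Γ u with
    | some (u', B) => if A.logical Ξ then some (inr A u', .sum A B) else none
    | _ => none
  | case u v w =>
    match r Γ u with
    | some (u', .sum A B) =>
      match r (A :: Γ) v, r (B :: Γ) w with
      | some (v', C), some (w', C') => if C' = C then some (case u' v' w', C) else none
      | _, _ => none
    | _ => none
  | con F u =>
    match r Γ u with
    | some (u', A) =>
      if (Ty.ind F).logical Ξ ∧ A = F.inst (.ind F) then some (con F u', .ind F) else none
    | _ => none
  | iter F C e u =>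
    match r Γ e, r Γ u with
    | some (e', A), some (u', B) =>
      if (Ty.ind F).logical Ξ ∧ C.logical Ξ ∧ A = .arr (F.inst C) C ∧ B = .ind F
      then some (iter F C e' u', C) else none
    | _, _ => none
  | ret u =>
    match r Γ u with
    | some (u', A) => if A.program Ξ then some (ret u', .mon A) else none
    | _ => none
  | bind u v =>
    match r Γ u with
    | some (u', .mon A) =>
      match r (A :: Γ) v with
      | some (v', .mon B) => some (bind u' v', .mon B)
      | _ => none
    | _ => none
  | fold A u =>
    match r Γ u with
    | some (u', B) =>
      if A.program (Ξ + 1) ∧ B = A.inst (.mu A) then some (fold A u', .mu A) else none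
    | _ => none
  | unfold u =>
    match r Γ u with
    | some (u', .mu A) => some (unfold u', .mon (A.inst (.mu A)))
    | _ => none
  | get u =>
    match r Γ u with
    | some (u', .ref A) => some (get u', .mon A)
    | _ => none
  | set u v =>
    match r Γ u, r Γ v with
    | some (u', .ref A), some (v', A') => if A' = A then some (set u' v', .mon .unit) else none
    | _, _ => none
  | step => some (step, .mon .unit)
  | eq A u v =>
    match r Γ u, r Γ v with
    | some (u', B), some (v', C) =>
      if A.logical Ξ ∧ B = A ∧ C = A then some (eq A u' v', .prop) else none
    | _, _ => none
  | top => some (top, .prop)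
  | imp φ ψ =>
    match r Γ φ, r Γ ψ with
    | some (φ', .prop), some (ψ', .prop) => some (imp φ' ψ', .prop)
    | _, _ => none
  | and φ ψ =>
    match r Γ φ, r Γ ψ with
    | some (φ', .prop), some (ψ', .prop) => some (and φ' ψ', .prop)
    | _, _ => none
  | sep φ ψ =>
    match r Γ φ, r Γ ψ with
    | some (φ', .prop), some (ψ', .prop) => some (sep φ' ψ', .prop)
    | _, _ => none
  | wand φ ψ =>
    match r Γ φ, r Γ ψ with
    | some (φ', .prop), some (ψ', .prop) => some (wand φ' ψ', .prop)
    | _, _ => none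
  | all A φ =>
    match r (A :: Γ) φ with
    | some (φ', .prop) => if A.logical Ξ then some (all A φ', .prop) else none
    | _ => none
  | ex A φ =>
    match r (A :: Γ) φ with
    | some (φ', .prop) => if A.logical Ξ then some (ex A φ', .prop) else none
    | _ => none
  | later φ =>
    match r Γ φ with
    | some (φ', .prop) => some (later φ', .prop)
    | _ => none
  | pts l u =>
    match r Γ l, r Γ u with
    | some (l', .ref A), some (u', A') => if A' = A then some (pts l' u', .prop) else none
    | _, _ => none
  | wp e φ =>
    match r Γ e with
    | some (e', .mon A) =>
      match r (A :: Γ) φ with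
      | some (φ', .prop) => some (wp e' φ', .prop)
      | _ => none
    | _ => none
  | _ => none

theorem normArgs_sound {Ξ : ℕ} {r : Ctx → Tm → Option (Tm × Ty)}
    (hr : ∀ {Γ u v A}, r Γ u = some (v, A) → Conv Ξ Γ u v A) {Γ : Ctx} {u v : Tm} {A : Ty}
    (h : normArgs Ξ r Γ u = some (v, A)) : Conv Ξ Γ u v A := by
  have left {Γ u v A} (h : r Γ u = some (v, A)) : HasType Ξ Γ u A := (hr h).left
  have right {Γ u v A} (h : r Γ u = some (v, A)) : HasType Ξ Γ v A := (hr h).right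
  have eqTm {Γ u v A} (h : r Γ u = some (v, A)) : EqTm Ξ Γ u v A := (hr h).eqTm
  unfold normArgs at h
  split at h
  all_goals try (repeat split at h)
  all_goals try cases h
  -- Variables of type `unit` are replaced by `tt`; this is the only η-law that the normaliser
  -- applies.
  next h => exact ⟨.var h, .tt, .unit_eta (.var h)⟩
  next h => exact ⟨.var h, .var h, .refl (.var h)⟩
  all_goals try simp_all only
  all_goals
    refine ⟨?_, ?_, ?_⟩
    · constructor <;>
        first
          | exact left (by assumption)
          | exact Ty.logical_sound (by tauto)
          | exact Ty.program_sound (by tauto)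
    · constructor <;>
        first
          | exact right (by assumption)
          | exact Ty.logical_sound (by tauto)
          | exact Ty.program_sound (by tauto)
    · first
        | apply EqTm.pair_congr
        | apply EqTm.fst_congr
        | apply EqTm.snd_congr
        | apply EqTm.lam_congr
        | apply EqTm.app_congr
        | apply EqTm.inl_congr
        | apply EqTm.inr_congr
        | apply EqTm.case_congr
        | apply EqTm.con_congr
        | apply EqTm.iter_congr
        | apply EqTm.ret_congr
        | apply EqTm.bind_congr
        | apply EqTm.fold_congr
        | apply EqTm.unfold_congr
        | apply EqTm.get_congr
        | apply EqTm.set_congr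
        | apply EqTm.eq_congr
        | apply EqTm.imp_congr
        | apply EqTm.and_congr
        | apply EqTm.sep_congr
        | apply EqTm.wand_congr
        | apply EqTm.all_congr
        | apply EqTm.ex_congr
        | apply EqTm.later_congr
        | apply EqTm.pts_congr
        | apply EqTm.wp_congr
        | exact .refl (by constructor)
      all_goals
        first
          | exact eqTm (by assumption)
          | exact Ty.logical_sound (by tauto)
          | exact Ty.program_sound (by tauto)

/-- β-normal form and type of a term, with fuel. -/
def norm (Ξ : ℕ) : ℕ → Ctx → Tm → Option (Tm × Ty)
  | 0, _, _ => none
  | n + 1, Γ, u =>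
    match normArgs Ξ (norm Ξ n) Γ u with
    | some (v, A) =>
      match contract v with
      | some v' =>
        match norm Ξ n Γ v' with
        | some (w, A') => if A' = A then some (w, A) else none
        | none => none
      | none => some (v, A)
    | none => none

theorem norm_sound {Ξ n : ℕ} {Γ : Ctx} {u v : Tm} {A : Ty} (h : norm Ξ n Γ u = some (v, A)) :
    Conv Ξ Γ u v A := by
  induction n generalizing Γ u v A with
  | zero => simp [norm] at h
  | succ n ih =>
    simp only [norm] at h
    split at h
    · next w B hw =>
      have hw := normArgs_sound ih hw
      split at h
      · next w' hw' =>
        split at h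
        · next x C hx =>
          split at h
          · next e =>
            cases h
            subst e
            have hx := ih hx
            -- The recursive call has inferred the type of the contractum, and the comparison of the
            -- two types takes the place of subject reduction.
            exact ⟨hw.left, hx.right, hw.eqTm.trans ((contract_sound hw.right hw').trans hx.eqTm)⟩
          · cases h
        · cases h
      · cases h
        exact hw
    · cases h

/-- A test for β-equality of well-typed terms. -/
def conv (Ξ n : ℕ) (Γ : Ctx) (u v : Tm) (A : Ty) : Bool :=
  match norm Ξ n Γ u, norm Ξ n Γ v with
  | some (u', B), some (v', C) => beq u' v' && (decide (B = A) && decide (C = A))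
  | _, _ => false

/-- Both terms are judgmentally equal to one common term. Confluence and termination are irrelevant:
if the fuel runs out or the results differ, the test fails. -/
theorem conv_sound {Ξ n : ℕ} {Γ : Ctx} {u v : Tm} {A : Ty} (h : conv Ξ n Γ u v A = true) :
    EqTm Ξ Γ u v A := by
  unfold conv at h
  split at h
  · next u' B v' C hu hv =>
    simp only [Bool.and_eq_true, decide_eq_true_eq] at h
    obtain ⟨h, rfl, rfl⟩ := h
    cases eq_of_beq h
    exact (norm_sound hu).eqTm.trans (norm_sound hv).eqTm.symm
  · cases h

end Tm


/-! ## Derived rules -/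

open Tm

/-- Unfolding a folded value costs one `step`. Reassociating brings this `step` to the front and
leaves a `ret` bound to the continuation, which is a redex for the normaliser. -/
theorem EqTm.unfold_fold_bind {Ξ : ℕ} {Γ : Ctx} {u v : Tm} {A B : Ty}
    (hA : IsTp .P (Ξ + 1) A) (hu : HasType Ξ Γ u (A.inst (.mu A)))
    (hu' : HasType Ξ (.unit :: Γ) (ret u.shift) (.mon (A.inst (.mu A))))
    (hv : HasType Ξ (A.inst (.mu A) :: Γ) v (.mon B)) :
    EqTm Ξ Γ (bind (unfold (fold A u)) v) (bind step (bind (ret u.shift) v.shift₁)) (.mon B) :=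
  (EqTm.bind_congr (.unfold_of_fold hA hu) (.refl hv)).trans (.bind_bind .step hu' hv)

namespace Entails

variable {Ξ : ℕ} {Γ : Ctx}

theorem refl {φ : Tm} (hφ : HasType Ξ Γ φ .prop) : Entails Ξ Γ φ φ := .conv (.refl hφ)

theorem sep_left {φ ψ : Tm} (hφ : HasType Ξ Γ φ .prop) (hψ : HasType Ξ Γ ψ .prop) :
    Entails Ξ Γ (sep φ ψ) φ := .cut (.sep_and hφ hψ) (.and_left hφ hψ)

theorem sep_right {φ ψ : Tm} (hφ : HasType Ξ Γ φ .prop) (hψ : HasType Ξ Γ ψ .prop) :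
    Entails Ξ Γ (sep φ ψ) ψ := .cut (.sep_and hφ hψ) (.and_right hφ hψ)

theorem wand_mp {φ ψ : Tm} (hφ : HasType Ξ Γ φ .prop) (hψ : HasType Ξ Γ ψ .prop) :
    Entails Ξ Γ (sep (wand φ ψ) φ) ψ := .wand_elim (.refl (.wand hφ hψ))

/-- Separating conjunction is left adjoint to the wand, so it commutes with existentials: the frame
moves to the right for the elimination and back afterwards. -/
theorem sep_ex_elim {φ χ ψ : Tm} {A : Ty} (hA : IsTp .L Ξ A) (hχ : HasType Ξ Γ χ .prop)
    (hψ : HasType Ξ Γ ψ .prop) (h : Entails Ξ (A :: Γ) (sep φ χ.shift) ψ.shift) :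
    Entails Ξ Γ (sep (ex A φ) χ) ψ :=
  .wand_elim (.ex_elim hA (.wand hχ hψ) (.wand_intro h))

/-- Reflexivity is the inverse Lawvere rule applied to the projection `⊤ ∧ x = y ⊢ x = y`, followed
by substitution of `u` for the variable. -/
theorem eq_refl {χ u : Tm} {A : Ty} (hΓ : IsCtx Ξ Γ) (hA : IsTp .L Ξ A)
    (hu : HasType Ξ Γ u A) (hχ : HasType Ξ Γ χ .prop) : Entails Ξ Γ χ (eq A u u) := by
  have h : Entails Ξ (A :: Γ) top (eq A (var 0) (var 0)) :=
    .lawvere_inv (φ := top) (ψ := eq A (var 1) (var 0)) hA .top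
      (.eq hA (.var rfl) (.var rfl)) (.and_right .top (.eq hA (.var rfl) (.var rfl)))
  have hσ : IsSubst Ξ Γ (single u) (A :: Γ) := by
    rintro (_ | i) B hB
    · cases hB
      exact hu
    · exact .var hB
  exact .cut (.top_intro hχ) (.subst hΓ (List.forall_mem_cons.mpr ⟨hA, hΓ⟩) hσ h)

/-- Replacing equals by equals, where `φ` and `ψ` are the weakenings of one predicate by a second
and by a first variable. -/
theorem eq_subst {χ φ ψ u v : Tm} {A : Ty} (hΓ : IsCtx Ξ Γ) (hA : IsTp .L Ξ A)
    (hu : HasType Ξ Γ u A) (hv : HasType Ξ Γ v A)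
    (hφ : HasType Ξ (A :: A :: Γ) φ .prop) (hψ : HasType Ξ (A :: A :: Γ) ψ .prop)
    (e : EqTm Ξ (A :: Γ) (φ.inst (var 0)) (ψ.inst (var 0)) .prop)
    (h : Entails Ξ Γ χ (eq A u v))
    (hχ : Entails Ξ Γ χ (φ.subst fun | 0 => v | 1 => u | i + 2 => var i)) :
    Entails Ξ Γ χ (ψ.subst fun | 0 => v | 1 => u | i + 2 => var i) := by
  have hσ : IsSubst Ξ Γ (fun | 0 => v | 1 => u | i + 2 => var i) (A :: A :: Γ) := by
    rintro (_ | _ | i) B hB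
    · cases hB
      exact hv
    · cases hB
      exact hu
    · exact .var hB
  -- By `e` the two predicates agree on the diagonal, which is the premise of the Lawvere rule. The
  -- equation and the predicate are joined by `∧`, so neither takes resources from the other.
  exact .cut (.and_intro hχ h) (.subst hΓ
    (List.forall_mem_cons.mpr ⟨hA, List.forall_mem_cons.mpr ⟨hA, hΓ⟩⟩) hσ
    (.lawvere hA hφ hψ (.conv e)))

/-- Propositional extensionality makes a derivable proposition provably equal to `top`, and equality
reflection makes this judgmental. It lets sum η be used for reasoning by cases. -/
theorem eqTm_top {φ : Tm} (hφ : HasType Ξ Γ φ .prop) (h : Entails Ξ Γ top φ) :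
    EqTm Ξ Γ φ top .prop :=
  .reflection (.prop_ext (.top_intro (.and .top hφ)) (.cut (.and_left .top .top) h))

/-- Case analysis on an element of a sum type. -/
theorem sum_cases {h u : Tm} {A B : Ty} (hA : IsTp .L Ξ A) (hB : IsTp .L Ξ B)
    (hh : HasType Ξ Γ h (.arr (.sum A B) .prop)) (hu : HasType Ξ Γ u (.sum A B))
    (tl : HasType Ξ (A :: Γ) (app h.shift (inl B (var 0))) .prop)
    (tr : HasType Ξ (B :: Γ) (app h.shift (inr A (var 0))) .prop)
    (hl : Entails Ξ (A :: Γ) top (app h.shift (inl B (var 0))))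
    (hr : Entails Ξ (B :: Γ) top (app h.shift (inr A (var 0)))) :
    Entails Ξ Γ top (app h u) := by
  have hS : IsTp .L Ξ (.sum A B) := .sum hA hB
  have beta {Δ : Ctx} {v : Tm} (hv : HasType Ξ Δ v (.sum A B)) :
      EqTm Ξ Δ (app (lam (.sum A B) top) v) top .prop := .arr_beta hS .top hv
  -- Sum η expands any predicate into a `case` of its values on the two injections. Those of `h` are
  -- derivable, hence judgmentally `top`, so `h` and the constant predicate `top` expand to the same
  -- term.
  have e₁ : EqTm Ξ Γ (app h u) (case u top top) .prop :=
    (EqTm.sum_eta hA hB hh hu).trans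
      (.case_congr (.refl hu) (eqTm_top tl hl) (eqTm_top tr hr))
  have e₂ : EqTm Ξ Γ (app (lam (.sum A B) top) u) (case u top top) .prop :=
    (EqTm.sum_eta hA hB (.lam hS .top) hu).trans
      (.case_congr (.refl hu) (beta (.inl hB (.var rfl))) (beta (.inr hA (.var rfl))))
  exact .conv ((beta hu).symm.trans (e₂.trans e₁.symm))

/-- The postcondition of `step` is only needed later, and here it holds already now, so a leading
`step` is absorbed by `later_intro`. -/
theorem wp_step_seq {χ e φ : Tm} {A : Ty} (he : HasType Ξ Γ e (.mon A))
    (he' : HasType Ξ (.unit :: Γ) e.shift (.mon A)) (hφ : HasType Ξ (A :: Γ) φ .prop)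
    (h : Entails Ξ Γ χ (wp e φ)) : Entails Ξ Γ χ (wp (seq step e) φ) :=
  .cut h <| .cut (.later_intro (.wp he hφ)) <|
    .cut (.wp_step (.wp he hφ)) (.wp_bind .step he' hφ)

/-- The frame `χ` itself proves `∀ x. φ -∗ ψ`, which is the form that `wp_wand` expects. -/
theorem wp_frame {χ e φ ψ : Tm} {A : Ty} (hA : IsTp .P Ξ A) (hχ : HasType Ξ Γ χ .prop)
    (he : HasType Ξ Γ e (.mon A)) (hφ : HasType Ξ (A :: Γ) φ .prop)
    (hψ : HasType Ξ (A :: Γ) ψ .prop) (h : Entails Ξ (A :: Γ) (sep χ.shift φ) ψ) :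
    Entails Ξ Γ (sep χ (wp e φ)) (wp e ψ) :=
  .cut (.sep_mono (.all_intro (.incl hA) hχ (.wand_intro h)) (.refl (.wp he hφ)))
    (.wp_wand hA he hφ hψ)

/-- A form of `wp_get` for known contents: `u` is the existential witness and the later is
introduced. The hypothesis `e`, that weakening followed by instantiation is the identity on `l`,
holds by `rfl` for the variables to which the rule is applied. -/
theorem wp_get_of_pts {ψ l u φ : Tm} {A : Ty} (hA : IsTp .P Ξ A) (hl : HasType Ξ Γ l (.ref A))
    (hl' : HasType Ξ (A :: Γ) l.shift (.ref A)) (e : l.shift.inst u = l) (hu : HasType Ξ Γ u A)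
    (hφ : HasType Ξ (A :: Γ) φ .prop) (hφ' : HasType Ξ Γ (φ.inst u) .prop)
    (h : Entails Ξ Γ (sep ψ (pts l u)) (φ.inst u)) :
    Entails Ξ Γ (sep (pts l u) ψ) (wp (get l) φ) := by
  have hp : HasType Ξ (A :: Γ) (pts l.shift (var 0)) .prop := .pts hl' (.var rfl)
  have hi := Entails.ex_intro (.incl hA) (.sep hp (.later (.wand hp hφ))) hu
  have e' : (sep (pts l.shift (var 0)) (later (wand (pts l.shift (var 0)) φ))).inst u =
      sep (pts l u) (later (wand (pts l u) (φ.inst u))) := by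
    conv_rhs => rw [← e]
    rfl
  rw [e'] at hi
  exact .cut (.sep_mono (.refl (.pts hl hu)) (.cut (.wand_intro h)
    (.later_intro (.wand (.pts hl hu) hφ')))) (.cut hi (.wp_get hA hl hφ))

/-- A form of `wp_set` for known old contents `u`, which serve only as the witness that the cell is
owned. -/
theorem wp_set_of_pts {ψ l u v φ : Tm} {A : Ty} (hA : IsTp .P Ξ A) (hl : HasType Ξ Γ l (.ref A))
    (hl' : HasType Ξ (A :: Γ) l.shift (.ref A)) (e : l.shift.inst u = l) (hu : HasType Ξ Γ u A)
    (hv : HasType Ξ Γ v A) (hφ : HasType Ξ Γ φ .prop)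
    (h : Entails Ξ Γ (sep ψ (pts l v)) φ) :
    Entails Ξ Γ (sep (pts l u) ψ) (wp (set l v) φ.shift) := by
  have hi := Entails.ex_intro (φ := pts l.shift (var 0)) (.incl hA) (.pts hl' (.var rfl)) hu
  have e' : (pts l.shift (var 0)).inst u = pts l u := by
    conv_rhs => rw [← e]
    rfl
  rw [e'] at hi
  exact .cut (.sep_mono hi (.wand_intro h)) (.wp_set hA hl hv hφ)

end Entails

/-! ## The specification of `append` -/

/-- All side conditions below concern concrete syntax, so they are default arguments filled in by
evaluation in the kernel. -/
theorem typed {Ξ : ℕ} {Γ : Ctx} {u : Tm} {A : Ty}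
    (h : infer Ξ Γ u = some A := by decide +kernel) : HasType Ξ Γ u A := infer_sound h

theorem logical {Ξ : ℕ} {A : Ty} (h : A.logical Ξ = true := by decide +kernel) : IsTp .L Ξ A :=
  Ty.logical_sound h

theorem program {Ξ : ℕ} {A : Ty} (h : A.program Ξ = true := by decide +kernel) : IsTp .P Ξ A :=
  Ty.program_sound h

theorem context {Ξ : ℕ} {Γ : Ctx}
    (h : (Γ.all fun A => A.logical Ξ) = true := by decide +kernel) : IsCtx Ξ Γ :=
  .of_logical h

/-- The number 50 is fuel, a bound on the recursion depth of the normaliser that suffices for the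
terms of this proof. -/
theorem converts {Ξ : ℕ} {Γ : Ctx} {u v : Tm} {A : Ty}
    (h : Tm.conv Ξ 50 Γ u v A = true := by decide +kernel) : EqTm Ξ Γ u v A := conv_sound h

theorem Entails.converts {Ξ : ℕ} {Γ : Ctx} {φ ψ : Tm}
    (h : Tm.conv Ξ 50 Γ φ ψ .prop = true := by decide +kernel) : Entails Ξ Γ φ ψ :=
  .conv (conv_sound h)

-- Types, contexts and programs of the proof

/-- The type variable of the list elements. -/
abbrev elTy : Ty := .var 0

/-- The values of imperative list nodes. -/
abbrev cell : Ty := .prod elTy (llist elTy)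

/-- The arguments of the constructor `cons`. -/
abbrev consArg : Ty := .prod elTy (list elTy)

/-- The functional list with constructor arguments `c`. -/
abbrev consOf (c : Tm) : Tm := con (listF elTy) (inr .unit c)

/-- The context of the lists `l₂`, `l₁`, `u₂` and of the arguments of the constructor `nil`. -/
abbrev nilCtx : Ctx := [llist elTy, llist elTy, list elTy, .unit, .sum .unit consArg]

/-- The context of the lists `l₂`, `l₁`, `u₂` and of the arguments of the constructor `cons`. -/
abbrev consCtx : Ctx := [llist elTy, llist elTy, list elTy, consArg, .sum .unit consArg]

/-- The extension of `consCtx` by the first reference `r` and the tail `l'` of `l₁`. -/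
abbrev nodeCtx : Ctx := llist elTy :: .ref cell :: consCtx

/-- Pairs of imperative lists, the arguments of `lappend`. -/
abbrev lpair : Ty := .prod (llist elTy) (llist elTy)

/-- The rest of the body of `lappend` after unfolding the first list to the variable 0, where `f`
is the recursive function and `l₂` is the second list. -/
def lappendMatch (f l₂ : Tm) : Tm :=
  case (var 0)
    (ret l₂.shift)
    (bind (get (var 0))
      (bind (app f.shift.shift (pair (snd (var 0)) l₂.shift.shift))
        (seq (set (var 2) (pair (fst (var 1)) (var 0)))
          (ret (lcons elTy (var 2))))))

/-- The function such that `lappend` is `unroll (fold lappendSelf)`. -/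
def lappendSelf : Tm :=
  lam (.mu (selfTy lpair (llist elTy))) (lam lpair (bind (unfold (fst (var 0)))
    (lappendMatch (unroll lpair (var 2)) (snd (var 1)))))

/-- The definiens of `lappend` applied to `p`. -/
def lappendUnroll (p : Tm) : Tm :=
  bind (unfold (fold (selfTy lpair (llist elTy)) lappendSelf))
    (app (app (var 0) (fold (selfTy lpair (llist elTy)) lappendSelf)) p.shift)

/-- The triple that specifies `lappend`, where `u`, `u₂` and `l₁`, `l₂` are the functional and
the imperative lists. -/
def appendTriple (u u₂ l₁ l₂ : Tm) : Tm :=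
  wand (sep (listInv elTy l₁ u) (listInv elTy l₂ u₂))
    (wp (app (lappend elTy) (pair l₁ l₂))
      (listInv elTy (var 0) (append elTy u.shift u₂.shift)))

/-- The specification of `lappend` for the functional list `u` as first argument. -/
def appendSpec (u : Tm) : Tm :=
  all (list elTy) (all (llist elTy) (all (llist elTy)
    (appendTriple u.shift.shift.shift (var 2) (var 1) (var 0))))

-- Symbolic execution of `lappend`

theorem lappend_lnil :
    EqTm 1 nilCtx
      (app (lappend elTy) (pair (lnil elTy) (var 0)))
      (seq step (seq step (ret (var 0)))) (.mon (llist elTy)) := by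
  -- This `step` comes from unfolding the linked list. The extra variable of type `unit` is the
  -- result of the other `step`, already executed.
  have e₁ : EqTm 1 (.unit :: nilCtx)
      (bind (unfold (lnil elTy)) (lappendMatch (lappend elTy) (var 2)))
      (seq step (ret (var 1))) (.mon (llist elTy)) :=
    (EqTm.unfold_fold_bind program typed typed typed).trans converts
  -- This `step` comes from unfolding the self-referential type behind `rec`; normalising then
  -- restores `lappend` in place of the recursive function.
  have e₂ : EqTm 1 nilCtx
      (lappendUnroll (pair (lnil elTy) (var 0)))
      (bind step (bind (unfold (lnil elTy)) (lappendMatch (lappend elTy) (var 2))))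
      (.mon (llist elTy)) :=
    (EqTm.unfold_fold_bind program typed typed typed).trans converts
  exact EqTm.trans converts (e₂.trans ((EqTm.bind_congr (.refl .step) e₁).trans converts))

theorem lappend_lcons :
    EqTm 1 nodeCtx
      (app (lappend elTy) (pair (lcons elTy (var 1)) (var 2)))
      (seq step (seq step (bind (get (var 1))
        (bind (app (lappend elTy) (pair (snd (var 0)) (var 3)))
          (seq (set (var 3) (pair (fst (var 1)) (var 0))) (ret (lcons elTy (var 3))))))))
      (.mon (llist elTy)) := by
  have e₁ : EqTm 1 (.unit :: nodeCtx)
      (bind (unfold (lcons elTy (var 2))) (lappendMatch (lappend elTy) (var 4)))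
      (seq step (bind (get (var 2))
        (bind (app (lappend elTy) (pair (snd (var 0)) (var 4)))
          (seq (set (var 4) (pair (fst (var 1)) (var 0))) (ret (lcons elTy (var 4)))))))
      (.mon (llist elTy)) :=
    (EqTm.unfold_fold_bind program typed typed typed).trans converts
  have e₂ : EqTm 1 nodeCtx
      (lappendUnroll (pair (lcons elTy (var 1)) (var 2)))
      (bind step (bind (unfold (lcons elTy (var 2))) (lappendMatch (lappend elTy) (var 4))))
      (.mon (llist elTy)) :=
    (EqTm.unfold_fold_bind program typed typed typed).trans converts
  exact EqTm.trans converts (e₂.trans ((EqTm.bind_congr (.refl .step) e₁).trans converts))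

-- The two cases of the induction

/-- The invariant of a nonempty list with head `x` and tail `xs`, in terms of the reference `r`
and the tail `l'`. -/
def consInv (l r l' x xs : Tm) : Tm :=
  sep (eq (llist elTy) l (lcons elTy r)) (sep (pts r (pair x l')) (listInv elTy l' xs))

theorem appendTriple_nil :
    Entails 1 nilCtx
      top (appendTriple (con (listF elTy) (inl consArg (var 3))) (var 2) (var 1) (var 0)) := by
  have h₁ : Entails 1 nilCtx
      (sep (eq (llist elTy) (var 1) (lnil elTy)) (listInv elTy (var 0) (var 2)))
      (wp (app (lappend elTy) (pair (lnil elTy) (var 0))) (listInv elTy (var 0) (var 3))) :=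
    -- The logic is affine, so the equation can be dropped: the invariant of `l₂` alone is the
    -- postcondition of `ret l₂`.
    .cut (.sep_right typed typed) <|
    .cut (.wp_step_seq (A := llist elTy) typed typed typed
      (.wp_step_seq (A := llist elTy) typed typed typed
      (.cut .converts (.wp_val (A := llist elTy) (φ := listInv elTy (var 0) (var 3))
        program typed typed)))) <|
    .conv (.wp_congr lappend_lnil.symm (.refl typed))
  have h₂ : Entails 1 nilCtx
      (sep (eq (llist elTy) (var 1) (lnil elTy)) (listInv elTy (var 0) (var 2)))
      (wp (app (lappend elTy) (pair (var 1) (var 0))) (listInv elTy (var 0) (var 3))) :=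
    -- The equation in the precondition is now used to replace `lnil` by the given list `l₁`.
    .cut (.eq_subst (A := llist elTy)
        (φ := wp (app (lappend elTy) (pair (var 0) (var 2))) (listInv elTy (var 0) (var 5)))
        (ψ := wp (app (lappend elTy) (pair (var 1) (var 2))) (listInv elTy (var 0) (var 5)))
        context logical typed typed typed typed converts (.sep_left typed typed)
        (.cut h₁ .converts))
      .converts
  exact .wand_intro (.cut (.sep_right typed typed) (.cut .converts (.cut h₂ .converts)))

/-- The triple of the commands in `lappend` after its recursive call. The result of this call is
the variable 0, and its postcondition is part of the precondition. -/
theorem wp_set_lcons :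
    Entails 1 (llist elTy :: nodeCtx)
      (sep (pts (var 2) (pair (fst (var 6)) (var 1)))
        (listInv elTy (var 0) (append elTy (snd (var 6)) (var 5))))
      (wp (seq (set (var 2) (pair (fst (var 6)) (var 0))) (ret (lcons elTy (var 2))))
        (listInv elTy (var 0) (append elTy (consOf (var 7)) (var 6)))) := by
  -- The invariant of the result has the new tail `l₃` and the old reference `r` as witnesses,
  -- introduced from the inside out. In the outer introduction the list on the left of the equation
  -- stays fixed, while the reference on the right is abstracted.
  have h₁ := Entails.ex_intro (Ξ := 1) (Γ := llist elTy :: nodeCtx) (A := llist elTy) (u := var 0)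
    (φ := consInv (lcons elTy (var 3)) (var 3) (var 0) (fst (var 7))
      (append elTy (snd (var 7)) (var 6)))
    logical typed typed
  have h₂ := Entails.ex_intro (Ξ := 1) (Γ := llist elTy :: nodeCtx) (A := .ref cell) (u := var 2)
    (φ := ex (llist elTy) (consInv (lcons elTy (var 4)) (var 1) (var 0) (fst (var 8))
      (append elTy (snd (var 8)) (var 7))))
    logical typed typed
  have h₃ : Entails 1 (llist elTy :: nodeCtx)
      (sep (listInv elTy (var 0) (append elTy (snd (var 6)) (var 5)))
        (pts (var 2) (pair (fst (var 6)) (var 0))))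
      (listInv elTy (lcons elTy (var 2)) (append elTy (consOf (var 6)) (var 5))) :=
    -- The required equation is reflexive, so it costs no resources: it takes the place of a unit
    -- `top` added to the conjunction.
    .cut (.sep_top typed) <| .cut (.sep_comm typed typed) <|
    .cut (.sep_mono (.eq_refl (A := llist elTy) (u := lcons elTy (var 2)) context logical typed
      typed) (.sep_comm typed typed)) <|
    .cut .converts <| .cut h₁ <| .cut .converts <| .cut h₂ .converts
  have h₄ := Entails.wp_set_of_pts (A := cell) (u := pair (fst (var 6)) (var 1)) (l := var 2)
    program typed typed rfl typed typed typed
    (.cut h₃ <| .cut .converts (.wp_val (A := llist elTy) (e := lcons elTy (var 2))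
      (φ := listInv elTy (var 0) (append elTy (consOf (var 7)) (var 6))) program typed typed))
  exact .cut h₄ <| .cut .converts <| .wp_bind (A := .unit) (B := llist elTy) typed typed typed

/-- The triple of `lappend` for a nonempty list, after the recursive call is accounted for. -/
theorem wp_lappend_lcons :
    Entails 1 nodeCtx
      (sep (pts (var 1) (pair (fst (var 5)) (var 0)))
        (wp (app (lappend elTy) (pair (var 0) (var 2)))
          (listInv elTy (var 0) (append elTy (snd (var 6)) (var 5)))))
      (wp (app (lappend elTy) (pair (lcons elTy (var 1)) (var 2)))
        (listInv elTy (var 0) (append elTy (consOf (var 6)) (var 5)))) := by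
  -- Ownership of the cell at `r` is framed around the recursive call; it then meets the
  -- postcondition of the call in the precondition of `wp_set_lcons`.
  have h₁ := Entails.wp_frame (A := llist elTy) (e := app (lappend elTy) (pair (var 0) (var 2)))
    (χ := pts (var 1) (pair (fst (var 5)) (var 0))) program typed typed typed typed wp_set_lcons
  -- The same triple, restated for the continuation of `get` with the contents of the cell
  -- substituted for the value read.
  have h₂ : Entails 1 nodeCtx
      (sep (wp (app (lappend elTy) (pair (var 0) (var 2)))
          (listInv elTy (var 0) (append elTy (snd (var 6)) (var 5))))
        (pts (var 1) (pair (fst (var 5)) (var 0))))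
      ((wp (bind (app (lappend elTy) (pair (snd (var 0)) (var 3)))
          (seq (set (var 3) (pair (fst (var 1)) (var 0))) (ret (lcons elTy (var 3)))))
        (listInv elTy (var 0) (append elTy (consOf (var 7)) (var 6)))).inst
          (pair (fst (var 5)) (var 0))) :=
    .cut (.sep_comm typed typed) <| .cut h₁ <| .cut .converts <|
    .cut (.wp_bind (A := llist elTy) (B := llist elTy)
      (e₁ := app (lappend elTy) (pair (var 0) (var 2)))
      (e₂ := seq (set (var 2) (pair (fst (var 6)) (var 0))) (ret (lcons elTy (var 2))))
      (φ := listInv elTy (var 0) (append elTy (consOf (var 6)) (var 5)))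
      typed typed typed) .converts
  have h₃ := Entails.wp_get_of_pts (A := cell) (l := var 1) program typed typed rfl typed typed
    typed h₂
  have h₄ := Entails.cut h₃ <| .cut .converts <| Entails.wp_bind (A := cell) (B := llist elTy)
    (φ := listInv elTy (var 0) (append elTy (consOf (var 6)) (var 5)))
    (e₁ := get (var 1)) (e₂ := bind (app (lappend elTy) (pair (snd (var 0)) (var 3)))
          (seq (set (var 3) (pair (fst (var 1)) (var 0))) (ret (lcons elTy (var 3)))))
    typed typed typed
  exact .cut (.wp_step_seq (A := llist elTy) typed typed typed
    (.wp_step_seq (A := llist elTy) typed typed typed h₄)) <|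
    .conv (.wp_congr lappend_lcons.symm (.refl typed))

/-- The induction hypothesis is a resource in the antecedent. The only recursive call uses it once,
instantiated at the tail `l'` with `u₂` and `l₂` unchanged. -/
theorem appendTriple_cons :
    Entails 1 consCtx (appendSpec (snd (var 3)))
      (appendTriple (consOf (var 3)) (var 2) (var 1) (var 0)) := by
  have hIH : Entails 1 nodeCtx (appendSpec (snd (var 5)))
      (appendTriple (snd (var 5)) (var 4) (var 0) (var 2)) :=
    .cut (.all_elim (u := var 4) logical typed typed) <|
    .cut (.all_elim (u := var 0) logical typed typed) <|
    .cut (.all_elim (u := var 2) logical typed typed) .converts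
  have h₁ : Entails 1 nodeCtx
      (sep (consInv (var 3) (var 1) (var 0) (fst (var 5)) (snd (var 5)))
        (sep (listInv elTy (var 2) (var 4)) (appendSpec (snd (var 5)))))
      (wp (app (lappend elTy) (pair (lcons elTy (var 1)) (var 2)))
        (listInv elTy (var 0) (append elTy (consOf (var 6)) (var 5)))) :=
    -- After the equation is dropped, the conjuncts are regrouped: the cell stays aside as a frame,
    -- and the invariants of `l'` and `l₂` form the precondition of the induction hypothesis.
    .cut (.sep_mono (.sep_right typed typed) (.refl typed)) <|
    .cut (.sep_assoc typed typed typed) <|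
    .cut (.sep_mono (.refl typed) <|
      .cut (.sep_assoc_inv typed typed typed) <|
      .cut (.sep_mono (.refl typed) hIH) <|
      .cut (.sep_comm typed typed) <| .wand_mp typed typed) wp_lappend_lcons
  have h₂ : Entails 1 nodeCtx
      (sep (consInv (var 3) (var 1) (var 0) (fst (var 5)) (snd (var 5)))
        (sep (listInv elTy (var 2) (var 4)) (appendSpec (snd (var 5)))))
      (wp (app (lappend elTy) (pair (var 3) (var 2)))
        (listInv elTy (var 0) (append elTy (consOf (var 6)) (var 5)))) :=
    .cut (.eq_subst (A := llist elTy)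
        (φ := wp (app (lappend elTy) (pair (var 0) (var 4)))
          (listInv elTy (var 0) (append elTy (consOf (var 8)) (var 7))))
        (ψ := wp (app (lappend elTy) (pair (var 1) (var 4)))
          (listInv elTy (var 0) (append elTy (consOf (var 8)) (var 7))))
        context logical typed typed typed typed converts
        (.cut (.sep_left typed typed) (.sep_left typed typed)) (.cut h₁ .converts))
      .converts
  have h₃ : Entails 1 consCtx
      (sep (ex (.ref cell) (ex (llist elTy)
          (consInv (var 3) (var 1) (var 0) (fst (var 5)) (snd (var 5)))))
        (sep (listInv elTy (var 0) (var 2)) (appendSpec (snd (var 3)))))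
      (wp (app (lappend elTy) (pair (var 1) (var 0)))
        (listInv elTy (var 0) (append elTy (consOf (var 4)) (var 3)))) :=
    -- Normalising the invariant of the nonempty list exposes its two existentials; they are opened
    -- with the other hypotheses as frame.
    .sep_ex_elim logical typed typed <| .sep_ex_elim logical typed typed <|
      .cut .converts <| .cut h₂ .converts
  exact .wand_intro <| .cut (.sep_comm typed typed) <| .cut (.sep_assoc typed typed typed) <|
    .cut .converts h₃

-- Assembling the induction

theorem appendSpec_con :
    Entails 1 [.sum .unit consArg]
      (Tm.lift (list elTy) (listF elTy) (lam (list elTy) (appendSpec (var 0))) (var 0))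
      (appendSpec (con (listF elTy) (var 0))) := by
  -- The induction hypothesis depends on the constructor argument under analysis, and `sum_cases`
  -- admits only the antecedent `top`. Hence it is moved into the predicate as the premise of an
  -- implication.
  let h : Tm := lam (.sum .unit consArg) (imp
    (Tm.lift (list elTy) (listF elTy) (lam (list elTy) (appendSpec (var 0))) (var 0))
    (appendSpec (con (listF elTy) (var 0))))
  have hl : Entails 1 [.unit, .sum .unit consArg] top (app h.shift (inl consArg (var 0))) :=
    .cut (.imp_intro <| .cut (.and_left (φ := top) (ψ := top) .top .top) <|
      .all_intro (A := list elTy) logical .top <|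
      .all_intro (A := llist elTy) logical .top <|
      .all_intro (A := llist elTy) logical .top appendTriple_nil) .converts
  have hr : Entails 1 [consArg, .sum .unit consArg] top (app h.shift (inr .unit (var 0))) :=
    .cut (.imp_intro <|
      -- On a `cons` argument the lifted predicate is a conjunction: the head is a constant position
      -- and contributes `top`, and the tail contributes the induction hypothesis.
      .cut (.and_right (φ := top) (ψ := and top (appendSpec (snd (var 0)))) .top typed) <|
      .cut (.and_right .top typed) <|
      .all_intro (A := list elTy) logical typed <|
      .all_intro (A := llist elTy) logical typed <|
      .all_intro (A := llist elTy) logical typed <| .cut .converts appendTriple_cons) .converts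
  have hs : Entails 1 [.sum .unit consArg] top (app h (var 0)) :=
    .sum_cases logical logical typed typed typed typed hl hr
  exact .cut (.and_intro (.top_intro typed) (.refl typed)) (.imp_elim (.cut hs .converts))

end LMuRef

open LMuRef LMuRef.Tm in
theorem mainTheorem3 :
    -- the type variable `α` is `Ty.var 0`; in the scope of the quantifiers,
    -- `u₁`, `u₂`, `l₁`, `l₂` are the variables 3, 2, 1, 0
    Entails 1 [] top
      (all (list (.var 0)) (all (list (.var 0)) (all (llist (.var 0)) (all (llist (.var 0))
        (wand
          (sep (listInv (.var 0) (var 1) (var 3)) (listInv (.var 0) (var 0) (var 2)))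
          (wp (app (lappend (.var 0)) (pair (var 1) (var 0)))
            -- under the binder of `x`, which is variable 0, the other indices move up by one
            (listInv (.var 0) (var 0) (append (.var 0) (var 4) (var 3))))))))) :=
  have h : Entails 1 [list elTy] top
      (app (lam (list elTy) (appendSpec (var 0))).shift (var 0)) :=
    -- Induction takes place in the empty context: the other three lists are bound inside the
    -- predicate, so the hypothesis is available for all of them.
    .induction (Γ := []) (χ := top) (P := lam (list elTy) (appendSpec (var 0)))
      logical .top typed <|
      .cut (.and_right .top typed) <| .cut .converts <| .cut appendSpec_con .converts
  .all_intro logical .top (.cut h .converts)
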